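/- Let $d\ge 1$, let $U\subset\mathbb R^d$ be open and bounded, let $a>0$, $\sigma^2>0$, $\gamma>0$, $\beta\ge 0$, $\theta\ge 1$, $R_0>0$, and let $\Delta^e,p\in\mathbb R$ satisfy $$\beta+2\le p<\frac{\theta+\gamma}{\beta+1}-\frac{2|\Delta^e|}{\sigma^2}.$$ Put $$q=\frac{(\theta+1)(\beta+2)}{\theta+\gamma+\beta+1},\qquad \zeta=\frac{\gamma+\beta}{\gamma+\beta+d(\beta+2)(\theta+1)},\qquad \epsilon_0=(1-\zeta)\Big(\frac{\beta+2}{q}-1\Big).$$ Then there is a constant $C_L>0$, depending only on $d,U,a,\sigma,\Delta^e,\gamma,\beta,\theta,p,R_0$, such that the following holds for all $r>2R_0$, all $T>0$ and all $u_0$ with $\operatorname{supp}u_0\subset B_{R_0}(0)$. Let $u\ge 0$ be a classical solution of $$\frac{\partial u}{\partial t}+\frac{\Delta^e}{a}u^\gamma|\nabla u|^\beta\sum_{i=1}^d\frac{\partial u}{\partial x_i}-\frac{\sigma^2}{2a}u^\gamma|\nabla u|^\beta\Delta u=0\ \text{ in } U\times(0,T],\qquad u(x,0)=u_0(x)\ \text{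 in } U,\qquad u=0\ \text{ on }\partial U\times(0,T),$$ that is, $u$ is continuous on $\overline U\times[0,T]$ and has continuous spatial derivatives up to order two and a continuous time derivative in $U\times(0,T]$. Let $w=u^{(\theta+\gamma+\beta+1)/(\beta+2)}$, $r_n=2r(1-2^{-(n+1)})$, $U_n=U\setminus B_{r_n}(0)$, and, for $n=0,1,2,\dots$, $$I_n(t)=\sup_{0<\tau<t}\int_{U_{n+1}}w^q\,dx+\int_0^t\int_{U_{n+1}}|\nabla w|^{\beta+2}\,dx\,d\tau\in[0,\infty].$$ If $$I_0(T)\le C_L^{-1/\epsilon_0}\,2^{-(\beta+2)/\epsilon_0^2}\,T^{-(\theta+1)/(\gamma+\beta)},$$ then $I_n(T)\to 0$ as $n\to\infty$. -/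

import Mathlib

open scoped ENNReal

noncomputable section

/-- Points of `ℝᵈ` with the Euclidean norm. -/
abbrev Space (d : ℕ) : Type := EuclideanSpace ℝ (Fin d)

/-- `u ∈ C^{2,1}_{x,t}(U_T)` for `U_T = U × (0,T]`: `u` is continuous on the closed cylinder
`closure U × [0,T]`, and on `U × (0,T]` it has continuous spatial derivatives up to order two and
a continuous time derivative (one-sided at `t = T`). -/
structure IsC21 {d : ℕ} (U : Set (Space d)) (T : ℝ) (u : Space d → ℝ → ℝ) : Prop where
  continuousOn_closure :
    ContinuousOn (fun z : Space d × ℝ => u z.1 z.2) (closure U ×ˢ Set.Icc 0 T)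
  contDiffOn_space : ∀ t ∈ Set.Ioc 0 T, ContDiffOn ℝ 2 (fun x => u x t) U
  continuousOn_fderiv :
    ContinuousOn (fun z : Space d × ℝ => fderiv ℝ (fun x => u x z.2) z.1) (U ×ˢ Set.Ioc 0 T)
  continuousOn_fderiv_two :
    ContinuousOn (fun z : Space d × ℝ => iteratedFDeriv ℝ 2 (fun x => u x z.2) z.1)
      (U ×ˢ Set.Ioc 0 T)
  differentiable_time : ∀ x ∈ U, ∀ t ∈ Set.Ioc 0 T,
    DifferentiableWithinAt ℝ (fun s => u x s) (Set.Iic T) t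
  continuousOn_deriv_time :
    ContinuousOn (fun z : Space d × ℝ => derivWithin (fun s => u z.1 s) (Set.Iic T) z.2)
      (U ×ˢ Set.Ioc 0 T)

/-- `u ≥ 0` is a classical solution of the initial-boundary value problem
`∂ₜu + (Δᵉ/a) u^γ |∇u|^β ∑ᵢ ∂ᵢu - (σ²/(2a)) u^γ |∇u|^β Δu = 0` in `U × (0,T]`,
`u(·,0) = u₀` in `U`, `u = 0` on `∂U × (0,T)`. Here `De` is the constant expected jump `Δᵉ`. -/
structure IsClassicalSolution {d : ℕ} (U : Set (Space d)) (T a σ De γ β : ℝ)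
    (u₀ : Space d → ℝ) (u : Space d → ℝ → ℝ) : Prop where
  regular : IsC21 U T u
  nonneg : ∀ x ∈ closure U, ∀ t ∈ Set.Icc 0 T, 0 ≤ u x t
  equation : ∀ x ∈ U, ∀ t ∈ Set.Ioc 0 T,
    derivWithin (fun s => u x s) (Set.Iic T) t
      + De / a * u x t ^ γ * ‖gradient (fun y => u y t) x‖ ^ β
          * ∑ i : Fin d, fderiv ℝ (fun y => u y t) x (EuclideanSpace.single i 1)
      - σ ^ 2 / (2 * a) * u x t ^ γ * ‖gradient (fun y => u y t) x‖ ^ β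
          * Laplacian.laplacian (fun y => u y t) x = 0
  initial : ∀ x ∈ U, u x 0 = u₀ x
  boundary : ∀ x ∈ frontier U, ∀ t ∈ Set.Ioo 0 T, u x t = 0

/-- The radii `r_n = 2r(1 - 1/2^{n+1})`. -/
def radius (r : ℝ) (n : ℕ) : ℝ := 2 * r * (1 - 1 / 2 ^ (n + 1))

/-- The shrinking exterior regions `U_n = U \ B_{r_n}(0)`. -/
def extRegion {d : ℕ} (U : Set (Space d)) (r : ℝ) (n : ℕ) : Set (Space d) :=
  U \ Metric.ball 0 (radius r n)

/-- The transformed function `w = u^{(θ+γ+β+1)/(β+2)}`. -/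
def wMap {d : ℕ} (θ γ β : ℝ) (u : Space d → ℝ → ℝ) (x : Space d) (t : ℝ) : ℝ :=
  u x t ^ ((θ + γ + β + 1) / (β + 2))

/-- The exponent `q = (θ+1)(β+2)/(θ+γ+β+1)`. -/
def qExp (θ γ β : ℝ) : ℝ := (θ + 1) * (β + 2) / (θ + γ + β + 1)

/-- The energy quantity
`I_n(t) = sup_{0<τ<t} ∫_{U_{n+1}} w^q dx + ∫₀ᵗ ∫_{U_{n+1}} |∇w|^{β+2} dx dτ`,
as an element of `[0,∞]`. -/
def energyI {d : ℕ} (U : Set (Space d)) (r θ γ β : ℝ) (u : Space d → ℝ → ℝ)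
    (n : ℕ) (t : ℝ) : ℝ≥0∞ :=
  (⨆ τ ∈ Set.Ioo 0 t,
      ∫⁻ x in extRegion U r (n + 1), ENNReal.ofReal (wMap θ γ β u x τ ^ qExp θ γ β))
    + ∫⁻ τ in Set.Ioo 0 t, ∫⁻ x in extRegion U r (n + 1),
        ENNReal.ofReal (‖gradient (fun y => wMap θ γ β u y τ) x‖ ^ (β + 2))

/-- The exponent `ζ = (γ+β)/(γ+β+d(β+2)(θ+1))`. -/
def zetaExp (d : ℕ) (θ γ β : ℝ) : ℝ :=
  (γ + β) / (γ + β + d * (β + 2) * (θ + 1))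

/-- The exponent `ε₀ = (1-ζ)((β+2)/q - 1)`. -/
def epsExp (d : ℕ) (θ γ β : ℝ) : ℝ :=
  (1 - zetaExp d θ γ β) * ((β + 2) / qExp θ γ β - 1)

end

/-! No iteration over `n` is needed: for a suitable `C_L` the smallness of `I_0(T)` forces `u` to
vanish for `|x| ≥ 17r/10` and `0 < t < T`. Since `r_2 = 7r/4`, every `I_n(T)` with `n ≥ 1` is then
zero. Only the supremum term of `I_0` is used; it bounds `∫ u^(θ+1)` over `|x| ≥ 3r/2`, because `w^q
= u^(θ+1)`. All arguments are of maximum-principle type, as the equation is not in divergence form.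

Time is removed first. The spatial operator is homogeneous of degree `γ+β+1` in `u`, so `t^(1/(γ+β))
u` is nondecreasing in time (`rpow_mul_monotone`). Hence each time slice satisfies a one-sided
elliptic inequality (`elliptic_inequality`).

Next comes a measure estimate of Aleksandrov–Bakelman–Pucci type (`exists_volume_superlevel_ge`).
Cusps `A|x-y|^((β+2)/(β+1))` are slid until they touch the slice from above. The vertex `y` is
recovered from the contact point by `x ↦ x - c|∇f|^β ∇f`. The cusp bounds its derivative on one side
and the elliptic inequality on the other, so the area formula makes the contact set large. Applied
at a maximum of `u (|x| - 3r/2)^d`, this turns the integral bound into `u^(γ+β) t ≤ ε (t/T)^ξ` for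
`|x| ≥ 8r/5`, with some `ξ > 0` (`exists_pointwise_bound`).

Finally, planar travelling fronts are supersolutions, so the support moves with finite speed
(`eq_zero_of_front_step`). On dyadic time intervals the factor `(t/T)^ξ` makes the displacements a
geometric series. Its sum is small with `ε`, so the support stays within `|x| < 17r/10`
(`eq_zero_of_pointwise_bound`). -/

/-! ### Contact conditions in space and one-sided derivative tests in time -/

/-- The second derivative of a function with a local maximum is negative semidefinite. -/
theorem IsLocalMax.fderiv_fderiv_apply_nonpos {E : Type*} [NormedAddCommGroup E] [NormedSpace ℝ E]
    {f : E → ℝ} {x : E} (hmax : IsLocalMax f x) (hf : ContDiffAt ℝ 2 f x) (v : E) :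
    fderiv ℝ (fderiv ℝ f) x v v ≤ 0 := by
  by_contra! hpos
  set L : ℝ → E := fun s => x + s • v with hL
  have hL0 : L 0 = x := by simp [hL]
  have hLd : ∀ s, HasDerivAt L v s := fun s => by
    have := ((hasDerivAt_id s).smul_const v).const_add x
    rwa [one_smul] at this
  have hLc : Filter.Tendsto L (nhds 0) (nhds x) := by
    have := (hLd 0).continuousAt.tendsto
    rwa [hL0] at this
  have hdiff : ∀ᶠ s in nhds (0 : ℝ), DifferentiableAt ℝ f (L s) := by
    have h1 : ∀ᶠ y in nhds x, ContDiffAt ℝ 2 f y := hf.eventually (by simp)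
    filter_upwards [hLc.eventually h1] with s hs
    exact hs.differentiableAt (by simp)
  have hder : deriv (fun s => f (L s)) =ᶠ[nhds 0] fun s => fderiv ℝ f (L s) v := by
    filter_upwards [hdiff] with s hs
    exact (hs.hasFDerivAt.comp_hasDerivAt s (hLd s)).deriv
  have hff : DifferentiableAt ℝ (fderiv ℝ f) x :=
    (hf.fderiv_right (m := 1) (by norm_num)).differentiableAt (by simp)
  have hdd : deriv (deriv (fun s => f (L s))) 0 = fderiv ℝ (fderiv ℝ f) x v v := by
    rw [hder.deriv_eq]
    have h1 : HasFDerivAt (fderiv ℝ f) (fderiv ℝ (fderiv ℝ f) x) (L 0) := by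
      rw [hL0]; exact hff.hasFDerivAt
    have h2 := h1.comp_hasDerivAt (0 : ℝ) (hLd 0)
    have h3 := (ContinuousLinearMap.apply ℝ ℝ v).hasFDerivAt.comp_hasDerivAt (0 : ℝ) h2
    exact h3.deriv
  have hcont : ContinuousAt (fun s => f (L s)) 0 := by
    refine ContinuousAt.comp (f := L) ?_ (hLd 0).continuousAt
    rw [hL0]; exact hf.continuousAt
  have hmax' : IsLocalMax (fun s => f (L s)) 0 := by
    have := hLc.eventually hmax
    filter_upwards [this] with s hs
    simpa [hL0] using hs
  -- A positive second derivative would make `0` a local minimum as well as a local maximum. The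
  -- restriction to the line would be locally constant, with zero second derivative.
  have hmin : IsLocalMin (fun s => f (L s)) 0 :=
    isLocalMin_of_deriv_deriv_pos (by rw [hdd]; exact hpos) hmax'.deriv_eq_zero hcont
  have hconst : (fun s => f (L s)) =ᶠ[nhds 0] fun _ => f (L 0) := by
    filter_upwards [hmax', hmin] with s h1 h2
    exact le_antisymm h1 h2
  have h0 : deriv (deriv (fun s => f (L s))) 0 = 0 := by
    rw [hconst.deriv.deriv_eq]
    simp
  rw [hdd] at h0
  exact hpos.ne' h0

theorem laplacian_eq_sum_fderiv_fderiv {d : ℕ} (f : Space d → ℝ) (x : Space d) :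
    Laplacian.laplacian f x = ∑ i : Fin d, fderiv ℝ (fderiv ℝ f) x
      (EuclideanSpace.single i 1) (EuclideanSpace.single i 1) := by
  rw [InnerProductSpace.laplacian_eq_iteratedFDeriv_orthonormalBasis f
    (EuclideanSpace.basisFun (Fin d) ℝ)]
  simp [iteratedFDeriv_two_apply]

/-- First and second order conditions at a point where `g` touches `f` from above. -/
theorem contact_conditions {d : ℕ} {f g : Space d → ℝ} {x : Space d}
    (hmax : IsLocalMax (fun y => f y - g y) x) (hf : ContDiffAt ℝ 2 f x)
    (hg : ContDiffAt ℝ 2 g x) :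
    fderiv ℝ f x = fderiv ℝ g x ∧ Laplacian.laplacian f x ≤ Laplacian.laplacian g x ∧
      ∀ v, fderiv ℝ (fderiv ℝ f) x v v ≤ fderiv ℝ (fderiv ℝ g) x v v := by
  have hfd := hf.differentiableAt (by simp)
  have hgd := hg.differentiableAt (by simp)
  have key : ∀ v, fderiv ℝ (fderiv ℝ f) x v v ≤ fderiv ℝ (fderiv ℝ g) x v v := by
    intro v
    have h := hmax.fderiv_fderiv_apply_nonpos (hf.sub hg) v
    have he : fderiv ℝ (fun y => f y - g y) =ᶠ[nhds x] fun y => fderiv ℝ f y - fderiv ℝ g y := by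
      filter_upwards [hf.eventually (by simp), hg.eventually (by simp)] with y h1 h2
      exact fderiv_fun_sub (h1.differentiableAt (by simp)) (h2.differentiableAt (by simp))
    have hff : DifferentiableAt ℝ (fderiv ℝ f) x :=
      (hf.fderiv_right (m := 1) (by norm_num)).differentiableAt (by simp)
    have hgg : DifferentiableAt ℝ (fderiv ℝ g) x :=
      (hg.fderiv_right (m := 1) (by norm_num)).differentiableAt (by simp)
    rw [he.fderiv_eq, fderiv_fun_sub hff hgg] at h
    simpa using h
  refine ⟨?_, ?_, key⟩
  · have h := hmax.fderiv_eq_zero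
    rw [fderiv_fun_sub hfd hgd] at h
    exact sub_eq_zero.mp h
  · rw [laplacian_eq_sum_fderiv_fderiv, laplacian_eq_sum_fderiv_fderiv]
    exact Finset.sum_le_sum fun i _ => key _

theorem norm_gradient_eq {d : ℕ} (f : Space d → ℝ) (x : Space d) :
    ‖gradient f x‖ = ‖fderiv ℝ f x‖ := by
  simp [gradient]

theorem abs_sum_apply_single_le {d : ℕ} (L : Space d →L[ℝ] ℝ) :
    |∑ i : Fin d, L (EuclideanSpace.single i 1)| ≤ d * ‖L‖ := by
  calc |∑ i : Fin d, L (EuclideanSpace.single i 1)|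
      ≤ ∑ i : Fin d, |L (EuclideanSpace.single i 1)| := Finset.abs_sum_le_sum_abs _ _
    _ ≤ ∑ _i : Fin d, ‖L‖ := by
        refine Finset.sum_le_sum fun i _ => ?_
        have := L.le_opNorm (EuclideanSpace.single i 1)
        simpa using this
    _ = d * ‖L‖ := by simp

/-- Only the past is inspected, so that parabolic comparison also works at the final time `T`. -/
theorem HasDerivWithinAt.nonneg_of_eventually_le {f : ℝ → ℝ} {f' a : ℝ}
    (hf : HasDerivWithinAt f f' (Set.Iic a) a) (h : ∀ᶠ s in nhdsWithin a (Set.Iio a), f s ≤ f a) :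
    0 ≤ f' := by
  have h1 : HasDerivWithinAt f f' (Set.Iio a) a := hf.mono Set.Iio_subset_Iic_self
  rw [hasDerivWithinAt_iff_tendsto_slope' (by simp)] at h1
  refine ge_of_tendsto h1 ?_
  filter_upwards [h, self_mem_nhdsWithin] with s hs hlt
  have hlt' : s - a < 0 := sub_neg.mpr hlt
  rw [slope_def_field]
  exact div_nonneg_of_nonpos (by linarith) hlt'.le

theorem HasDerivWithinAt.nonpos_of_eventually_ge {f : ℝ → ℝ} {f' a : ℝ}
    (hf : HasDerivWithinAt f f' (Set.Iic a) a) (h : ∀ᶠ s in nhdsWithin a (Set.Iio a), f a ≤ f s) :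
    f' ≤ 0 := by
  have := HasDerivWithinAt.nonneg_of_eventually_le (f := fun s => - f s) hf.neg
    (by filter_upwards [h] with s hs; linarith)
  linarith

/-! ### Basic properties of classical solutions -/

namespace IsClassicalSolution

variable {d : ℕ} {U : Set (Space d)} {T a σ De γ β : ℝ} {u₀ : Space d → ℝ}
  {u : Space d → ℝ → ℝ}

/-- The solution vanishes on the boundary also at the two end times. -/
theorem eq_zero_of_mem_frontier (h : IsClassicalSolution U T a σ De γ β u₀ u) (hT : 0 < T)
    {x : Space d} (hx : x ∈ frontier U) {t : ℝ} (ht : t ∈ Set.Icc 0 T) : u x t = 0 := by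
  have hc : ContinuousOn (fun t => u x t) (Set.Icc 0 T) :=
    h.regular.continuousOn_closure.comp (f := fun t : ℝ => (x, t)) (by fun_prop)
      (fun t ht => ⟨frontier_subset_closure hx, ht⟩)
  have hcl : closure (Set.Ioo 0 T) = Set.Icc 0 T := closure_Ioo hT.ne
  have heq : Set.EqOn (fun t => u x t) (fun _ => 0) (Set.Icc 0 T) := by
    refine Set.EqOn.of_subset_closure (s := Set.Ioo 0 T) ?_ hc continuousOn_const
      Set.Ioo_subset_Icc_self hcl.ge
    exact fun t ht => h.boundary x hx t ht
  exact heq ht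

theorem continuousOn_slice (h : IsClassicalSolution U T a σ De γ β u₀ u) {t : ℝ}
    (ht : t ∈ Set.Icc 0 T) : ContinuousOn (fun x => u x t) (closure U) :=
  h.regular.continuousOn_closure.comp (f := fun x : Space d => (x, t)) (by fun_prop)
    (fun _ hx => ⟨hx, ht⟩)

theorem contDiffAt (h : IsClassicalSolution U T a σ De γ β u₀ u) (hU : IsOpen U) {x : Space d}
    (hx : x ∈ U) {t : ℝ} (ht : t ∈ Set.Ioc 0 T) : ContDiffAt ℝ 2 (fun y => u y t) x :=
  (h.regular.contDiffOn_space t ht).contDiffAt (hU.mem_nhds hx)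

/-- The equation, solved for the left time derivative. -/
theorem hasDerivWithinAt (h : IsClassicalSolution U T a σ De γ β u₀ u) {x : Space d}
    (hx : x ∈ U) {t : ℝ} (ht : t ∈ Set.Ioc 0 T) :
    HasDerivWithinAt (fun s => u x s) (u x t ^ γ * ‖fderiv ℝ (fun y => u y t) x‖ ^ β *
      (σ ^ 2 / (2 * a) * Laplacian.laplacian (fun y => u y t) x
        - De / a * ∑ i : Fin d, fderiv ℝ (fun y => u y t) x (EuclideanSpace.single i 1)))
      (Set.Iic t) t := by
  have h1 := (h.regular.differentiable_time x hx t ht).hasDerivWithinAt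
  have h2 := h.equation x hx t ht
  rw [norm_gradient_eq] at h2
  refine (h1.mono (Set.Iic_subset_Iic.mpr ht.2)).congr_deriv ?_
  linarith

end IsClassicalSolution

/-! ### Monotonicity in time and the elliptic inequality -/

/-- The pointwise contradiction in the doubling argument that follows: `P < S` will be the two
times, `pS` the gradient norm at the later time, and `Es`, `Et` the linear second-order expressions.
Homogeneity transfers `hs` from the later time to the earlier one with factor `Λ^(β+1)`. Because
`Λ^(γ+β) ≥ S/P` and `ut > Λ us` strictly (this is where `δ > 0` counts), the result is incompatible
with `ht`. -/
theorem benilan_crandall_contradiction {γ β δ R P S ut us pS Es Et : ℝ} (hγ : 0 < γ)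
    (hβ : 0 ≤ β) (hδ : 0 < δ) (hR : 1 < R) (hP : 0 < P) (hS : 0 < S) (hus : 0 ≤ us)
    (hpS : 0 ≤ pS) {Λ : ℝ} (hΛ : Λ = R * (S / P) ^ (1 / (γ + β))) (hut : ut = Λ * (us + δ))
    (hE : Et ≤ Λ * Es)
    (hs : us ^ γ * pS ^ β * Es ≤ -((us + δ) / ((γ + β) * S)))
    (ht : -(ut / ((γ + β) * P)) ≤ ut ^ γ * (Λ * pS) ^ β * Et) : False := by
  have hm : 0 < γ + β := by linarith
  have hq : 0 < (S / P) ^ (1 / (γ + β)) := Real.rpow_pos_of_pos (div_pos hS hP) _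
  have hΛ0 : 0 < Λ := by rw [hΛ]; positivity
  have hΛm : S / P ≤ Λ ^ (γ + β) := by
    rw [hΛ, Real.mul_rpow (by linarith) hq.le, ← Real.rpow_mul (div_pos hS hP).le,
      one_div_mul_cancel hm.ne', Real.rpow_one]
    have h1 : 1 ≤ R ^ (γ + β) := Real.one_le_rpow hR.le hm.le
    nlinarith [div_pos hS hP]
  -- At `us = 0` the degenerate factor kills the left side of `hs`, while its right side is
  -- negative.
  have hus0 : 0 < us := by
    rcases hus.eq_or_lt with h0 | h0
    · rw [← h0, Real.zero_rpow hγ.ne'] at hs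
      have : 0 < (0 + δ) / ((γ + β) * S) := by positivity
      simp only [zero_mul] at hs
      linarith
    · exact h0
  have hut0 : 0 < ut := by rw [hut]; positivity
  have husγ : 0 < us ^ γ := Real.rpow_pos_of_pos hus0 _
  have hutγ : 0 < ut ^ γ := Real.rpow_pos_of_pos hut0 _
  have hpb : 0 ≤ pS ^ β := Real.rpow_nonneg hpS _
  have hΛb : 0 < Λ ^ β := Real.rpow_pos_of_pos hΛ0 _
  have h1 : pS ^ β * Es ≤ -((us + δ) / ((γ + β) * S)) / us ^ γ := by
    rw [le_div_iff₀ husγ]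
    linarith
  have h2 : ut ^ γ * (Λ * pS) ^ β * Et ≤
      ut ^ γ * Λ ^ β * Λ * (-((us + δ) / ((γ + β) * S)) / us ^ γ) := by
    rw [Real.mul_rpow hΛ0.le hpS]
    calc ut ^ γ * (Λ ^ β * pS ^ β) * Et ≤ ut ^ γ * (Λ ^ β * pS ^ β) * (Λ * Es) := by gcongr
      _ = ut ^ γ * Λ ^ β * Λ * (pS ^ β * Es) := by ring
      _ ≤ _ := by gcongr
  have h3 : Λ ^ γ * us ^ γ < ut ^ γ := by
    rw [← Real.mul_rpow hΛ0.le hus0.le]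
    refine Real.rpow_lt_rpow (by positivity) ?_ hγ
    rw [hut]
    nlinarith
  have h4 : ut ^ γ * Λ ^ β * Λ * (-((us + δ) / ((γ + β) * S)) / us ^ γ)
      = -(ut ^ γ * Λ ^ β * ut / ((γ + β) * S * us ^ γ)) := by
    rw [hut]; field_simp
  have h5 : ut / ((γ + β) * P) < ut ^ γ * Λ ^ β * ut / ((γ + β) * S * us ^ γ) := by
    rw [div_lt_div_iff₀ (by positivity) (by positivity)]
    have h6 : S ≤ Λ ^ γ * Λ ^ β * P := by
      rw [← Real.rpow_add hΛ0]
      rwa [div_le_iff₀ hP] at hΛm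
    calc ut * ((γ + β) * S * us ^ γ) ≤ ut * ((γ + β) * (Λ ^ γ * Λ ^ β * P) * us ^ γ) := by gcongr
      _ = (Λ ^ γ * us ^ γ) * (Λ ^ β * ut * ((γ + β) * P)) := by ring
      _ < ut ^ γ * (Λ ^ β * ut * ((γ + β) * P)) := by gcongr
      _ = _ := by ring
  linarith

theorem neg_div_le_of_deriv_rpow_mul_nonneg {m t v w : ℝ} (hm : 0 < m) (ht : 0 < t)
    (h : 0 ≤ 1 / m * t ^ (1 / m - 1) * v + t ^ (1 / m) * w) : -(v / (m * t)) ≤ w := by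
  have hmul : t ^ (1 / m) = t * t ^ (1 / m - 1) := by
    rw [← Real.rpow_one_add' ht.le (by ring_nf; positivity)]; ring_nf
  have htk1 : 0 < t ^ (1 / m - 1) := Real.rpow_pos_of_pos ht _
  rw [hmul] at h
  have h4 : 0 ≤ t ^ (1 / m - 1) * (t * (v / (m * t) + w)) := by
    have : t * (v / (m * t) + w) = 1 / m * v + t * w := by field_simp
    rw [this]; linarith
  have h5 := nonneg_of_mul_nonneg_right (nonneg_of_mul_nonneg_right h4 htk1) ht
  linarith

namespace IsClassicalSolution

variable {d : ℕ} {U : Set (Space d)} {T a σ De γ β : ℝ} {u₀ : Space d → ℝ}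
  {u : Space d → ℝ → ℝ}

/-- The time variable is doubled, which avoids differentiating the equation in time. At a maximum of
the quotient of the two sides over `(x, t, s)` with `t ≤ s`, the slice at time `t` touches a
multiple of the slice at time `s` from below, and the left time derivatives have opposite one-sided
bounds. The shift `δ` keeps the denominator positive. -/
theorem rpow_mul_le_rpow_mul_add (h : IsClassicalSolution U T a σ De γ β u₀ u) (hU : IsOpen U)
    (hUb : Bornology.IsBounded U) (ha : 0 < a) (hγ : 0 < γ) (hβ : 0 ≤ β) {δ : ℝ} (hδ : 0 < δ)
    {x₁ : Space d} (hx₁ : x₁ ∈ U) {t₁ s₁ : ℝ} (ht₁ : 0 < t₁) (hts₁ : t₁ ≤ s₁) (hs₁ : s₁ ≤ T) :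
    t₁ ^ (1 / (γ + β)) * u x₁ t₁ ≤ s₁ ^ (1 / (γ + β)) * (u x₁ s₁ + δ) := by
  by_contra! hcon
  have hm : 0 < γ + β := by linarith
  set k : ℝ := 1 / (γ + β) with hk
  have hk0 : 0 < k := by positivity
  have hT : 0 < T := by linarith
  have hcpt : IsCompact (closure U) := hUb.isCompact_closure
  have hQ : IsCompact (closure U ×ˢ Set.Icc (0 : ℝ) T) := hcpt.prod isCompact_Icc
  have huc := hQ.uniformContinuousOn_of_continuous h.regular.continuousOn_closure
  rw [Metric.uniformContinuousOn_iff] at huc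
  obtain ⟨ω, hω, huc⟩ := huc δ hδ
  -- Uniform continuity keeps violating pairs at least `ω` apart in time. So `s` can be decreased
  -- slightly without leaving the constraint `t ≤ s`.
  have hlarge : ∀ x ∈ closure U, ∀ t s, 0 ≤ t → t ≤ s → s ≤ T →
      s ^ k * (u x s + δ) < t ^ k * u x t → 0 < t ∧ t + ω ≤ s := by
    intro x hx t s ht hts hs hlt
    have hsu : 0 ≤ u x s := h.nonneg x hx s ⟨by linarith, hs⟩
    have htpos : 0 < t := by
      rcases ht.eq_or_lt with h0 | h0
      · subst h0
        rw [Real.zero_rpow hk0.ne', zero_mul] at hlt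
        have : 0 ≤ s ^ k := Real.rpow_nonneg hts _
        nlinarith
      · exact h0
    refine ⟨htpos, ?_⟩
    by_contra! hcl
    have hd := huc (x, t) ⟨hx, ht, by linarith⟩ (x, s) ⟨hx, by linarith, hs⟩ (by
      rw [Prod.dist_eq, dist_self, Real.dist_eq, abs_sub_comm, abs_of_nonneg (by linarith)]
      simpa using ⟨hω, by linarith⟩)
    rw [Real.dist_eq] at hd
    have hd' := (abs_lt.mp hd).2
    simp only at hd'
    have h1 : t ^ k ≤ s ^ k := Real.rpow_le_rpow ht hts hk0.le
    have h2 : 0 < t ^ k := Real.rpow_pos_of_pos htpos _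
    nlinarith
  -- The cut `ω ≤ s` keeps `s^k` away from zero and excludes no violation.
  set K : Set (Space d × ℝ × ℝ) := {z | z.1 ∈ closure U ∧ 0 ≤ z.2.1 ∧ z.2.1 ≤ z.2.2 ∧
    ω ≤ z.2.2 ∧ z.2.2 ≤ T} with hKdef
  have hKc : IsCompact K := by
    have hbig : IsCompact (closure U ×ˢ (Set.Icc (0 : ℝ) T ×ˢ Set.Icc (0 : ℝ) T)) :=
      hcpt.prod (isCompact_Icc.prod isCompact_Icc)
    refine hbig.of_isClosed_subset ?_ ?_
    · have hc1 : Continuous fun z : Space d × ℝ × ℝ => z.2.1 := by fun_prop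
      have hc2 : Continuous fun z : Space d × ℝ × ℝ => z.2.2 := by fun_prop
      exact (isClosed_closure.preimage continuous_fst).inter
        ((isClosed_le continuous_const hc1).inter ((isClosed_le hc1 hc2).inter
          ((isClosed_le continuous_const hc2).inter (isClosed_le hc2 continuous_const))))
    · rintro ⟨x, t, s⟩ ⟨h1, h2, h3, h4, h5⟩
      exact ⟨h1, ⟨h2, h3.trans h5⟩, ⟨h2.trans h3, h5⟩⟩
  have hK1 : (x₁, t₁, s₁) ∈ K := by
    have := hlarge x₁ (subset_closure hx₁) t₁ s₁ ht₁.le hts₁ hs₁ hcon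
    exact ⟨subset_closure hx₁, ht₁.le, hts₁, by simp only; linarith, hs₁⟩
  have hden : ∀ z ∈ K, 0 < z.2.2 ^ k * (u z.1 z.2.2 + δ) := by
    rintro ⟨x, t, s⟩ ⟨h1, h2, h3, h4, h5⟩
    have hs0 : 0 < s := by simp only at h4; linarith
    have := h.nonneg x h1 s ⟨hs0.le, h5⟩
    exact mul_pos (Real.rpow_pos_of_pos hs0 _) (by simp only; linarith)
  have hcont : ContinuousOn (fun z : Space d × ℝ × ℝ =>
      (z.2.1 ^ k * u z.1 z.2.1) / (z.2.2 ^ k * (u z.1 z.2.2 + δ))) K := by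
    have hut : ContinuousOn (fun z : Space d × ℝ × ℝ => u z.1 z.2.1) K :=
      h.regular.continuousOn_closure.comp (f := fun z : Space d × ℝ × ℝ => (z.1, z.2.1))
        (by fun_prop) (by
          rintro ⟨x, t, s⟩ ⟨h1, h2, h3, h4, h5⟩
          exact ⟨h1, h2, h3.trans h5⟩)
    have hus : ContinuousOn (fun z : Space d × ℝ × ℝ => u z.1 z.2.2) K :=
      h.regular.continuousOn_closure.comp (f := fun z : Space d × ℝ × ℝ => (z.1, z.2.2))
        (by fun_prop) (by
          rintro ⟨x, t, s⟩ ⟨h1, h2, h3, h4, h5⟩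
          exact ⟨h1, h2.trans h3, h5⟩)
    have hp1 : ContinuousOn (fun z : Space d × ℝ × ℝ => z.2.1 ^ k) K :=
      (continuous_fst.comp continuous_snd).continuousOn.rpow_const fun _ _ => Or.inr hk0.le
    have hp2 : ContinuousOn (fun z : Space d × ℝ × ℝ => z.2.2 ^ k) K :=
      (continuous_snd.comp continuous_snd).continuousOn.rpow_const fun _ _ => Or.inr hk0.le
    exact (hp1.mul hut).div (hp2.mul (hus.add continuousOn_const)) fun z hz => (hden z hz).ne'
  obtain ⟨⟨x₀, t₀, s₀⟩, hz₀, hmax⟩ := hKc.exists_isMaxOn ⟨_, hK1⟩ hcont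
  set R : ℝ := (t₀ ^ k * u x₀ t₀) / (s₀ ^ k * (u x₀ s₀ + δ)) with hR
  have hle : ∀ x t s, (x, t, s) ∈ K → t ^ k * u x t ≤ R * (s ^ k * (u x s + δ)) := by
    intro x t s hz
    have h1 := hmax hz
    simp only [Set.mem_ofPred_eq] at h1
    rwa [div_le_iff₀ (hden _ hz)] at h1
  have hR1 : 1 < R := by
    have h1 := hle _ _ _ hK1
    have h2 := hden _ hK1
    simp only at h2
    by_contra! h3
    nlinarith
  have hden₀ := hden _ hz₀
  simp only at hden₀
  have heq : t₀ ^ k * u x₀ t₀ = R * (s₀ ^ k * (u x₀ s₀ + δ)) := by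
    rw [hR, div_mul_cancel₀ _ hden₀.ne']
  obtain ⟨hx₀, ht₀, hts₀, hωs₀, hs₀⟩ := hz₀
  simp only at hx₀ ht₀ hts₀ hωs₀ hs₀
  obtain ⟨htpos, hgap⟩ := hlarge x₀ hx₀ t₀ s₀ ht₀ hts₀ hs₀ (by rw [heq]; nlinarith)
  have hspos : 0 < s₀ := by linarith
  have htk : 0 < t₀ ^ k := Real.rpow_pos_of_pos htpos _
  have hsk : 0 < s₀ ^ k := Real.rpow_pos_of_pos hspos _
  have hus0 : 0 ≤ u x₀ s₀ := h.nonneg x₀ hx₀ s₀ ⟨hspos.le, hs₀⟩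
  have hut0 : 0 < u x₀ t₀ := by
    have h1 : 0 < t₀ ^ k * u x₀ t₀ := by rw [heq]; positivity
    exact (mul_pos_iff_of_pos_left htk).mp h1
  have htI : t₀ ∈ Set.Ioc 0 T := ⟨htpos, by linarith⟩
  have hsI : s₀ ∈ Set.Ioc 0 T := ⟨hspos, hs₀⟩
  have hxU : x₀ ∈ U := by
    by_contra hx
    have hf : x₀ ∈ frontier U := ⟨hx₀, by rwa [hU.interior_eq]⟩
    exact hut0.ne' (h.eq_zero_of_mem_frontier hT hf ⟨htpos.le, htI.2⟩)
  set Λ : ℝ := R * (s₀ / t₀) ^ k with hΛ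
  have hΛ' : Λ * t₀ ^ k = R * s₀ ^ k := by
    rw [hΛ, Real.div_rpow hspos.le htpos.le]
    field_simp
  have hutΛ : u x₀ t₀ = Λ * (u x₀ s₀ + δ) := by
    refine mul_left_cancel₀ htk.ne' ?_
    calc t₀ ^ k * u x₀ t₀ = R * s₀ ^ k * (u x₀ s₀ + δ) := by rw [heq]; ring
      _ = _ := by rw [← hΛ']; ring
  have hcd_t := h.contDiffAt hU hxU htI
  have hcd_s := h.contDiffAt hU hxU hsI
  have hΛ0 : 0 < Λ := by positivity
  have hloc : IsLocalMax (fun x => u x t₀ - Λ * (u x s₀ + δ)) x₀ := by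
    filter_upwards [hU.mem_nhds hxU] with x hx
    have h1 := hle x t₀ s₀ ⟨subset_closure hx, ht₀, hts₀, hωs₀, hs₀⟩
    have h2 : t₀ ^ k * u x t₀ ≤ t₀ ^ k * (Λ * (u x s₀ + δ)) := by
      calc _ ≤ R * s₀ ^ k * (u x s₀ + δ) := by rw [mul_assoc]; exact h1
        _ = _ := by rw [← hΛ']; ring
    have h3 := le_of_mul_le_mul_left h2 htk
    linarith
  have hgcd : ContDiffAt ℝ 2 (fun x => Λ * (u x s₀ + δ)) x₀ :=
    contDiffAt_const.mul (hcd_s.add contDiffAt_const)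
  obtain ⟨hfd, hlap, -⟩ := contact_conditions hloc hcd_t hgcd
  have hfdg : ∀ y, DifferentiableAt ℝ (fun x => u x s₀) y →
      fderiv ℝ (fun x => Λ * (u x s₀ + δ)) y = Λ • fderiv ℝ (fun x => u x s₀) y := by
    intro y hy
    rw [fderiv_const_mul (hy.add_const δ), fderiv_add_const]
  have hlapg : Laplacian.laplacian (fun x => Λ * (u x s₀ + δ)) x₀
      = Λ * Laplacian.laplacian (fun x => u x s₀) x₀ := by
    have hev : fderiv ℝ (fun x => Λ * (u x s₀ + δ)) =ᶠ[nhds x₀]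
        fun y => Λ • fderiv ℝ (fun x => u x s₀) y := by
      filter_upwards [hcd_s.eventually (by simp)] with y hy
      exact hfdg y (hy.differentiableAt (by simp))
    have hff : DifferentiableAt ℝ (fderiv ℝ (fun x => u x s₀)) x₀ :=
      (hcd_s.fderiv_right (m := 1) (by norm_num)).differentiableAt (by simp)
    rw [laplacian_eq_sum_fderiv_fderiv, laplacian_eq_sum_fderiv_fderiv, hev.fderiv_eq,
      fderiv_fun_const_smul hff, Finset.mul_sum]
    simp
  rw [hfdg x₀ (hcd_s.differentiableAt (by simp))] at hfd
  rw [hlapg] at hlap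
  have hdt := h.hasDerivWithinAt hxU htI
  have hds := h.hasDerivWithinAt hxU hsI
  have hkd : ∀ t : ℝ, 0 < t → HasDerivWithinAt (fun s : ℝ => s ^ k) (k * t ^ (k - 1))
      (Set.Iic t) t := fun t ht =>
    (Real.hasDerivAt_rpow_const (Or.inl ht.ne')).hasDerivWithinAt
  have hmul : ∀ t : ℝ, 0 < t → t ^ k = t * t ^ (k - 1) := fun t ht => by
    rw [← Real.rpow_one_add' ht.le (by linarith)]; ring_nf
  refine benilan_crandall_contradiction hγ hβ hδ hR1 htpos hspos hus0
    (norm_nonneg (fderiv ℝ (fun y => u y s₀) x₀)) hΛ hutΛ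
    (Es := σ ^ 2 / (2 * a) * Laplacian.laplacian (fun y => u y s₀) x₀
        - De / a * ∑ i : Fin d, fderiv ℝ (fun y => u y s₀) x₀ (EuclideanSpace.single i 1))
    (Et := σ ^ 2 / (2 * a) * Laplacian.laplacian (fun y => u y t₀) x₀
        - De / a * ∑ i : Fin d, fderiv ℝ (fun y => u y t₀) x₀ (EuclideanSpace.single i 1))
    ?_ ?_ ?_
  · rw [hfd]
    simp only [smul_apply, smul_eq_mul, ← Finset.mul_sum]
    have hD : 0 ≤ σ ^ 2 / (2 * a) := by positivity
    nlinarith [mul_le_mul_of_nonneg_left hlap hD]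
  · have h1 := (hkd s₀ hspos).mul (hds.add_const δ)
    have h2 := h1.nonpos_of_eventually_ge (by
      filter_upwards [Ioo_mem_nhdsLT (show max t₀ ω < s₀ from max_lt (by linarith) (by linarith))]
        with s hs
      have hs1 := (le_max_left t₀ ω).trans_lt hs.1
      have hs2 := (le_max_right t₀ ω).trans_lt hs.1
      have h3 := hle x₀ t₀ s ⟨hx₀, ht₀, hs1.le, hs2.le, by simp only; linarith [hs.2]⟩
      rw [heq] at h3
      exact le_of_mul_le_mul_left h3 (by linarith))
    have hsk1 : 0 < s₀ ^ (k - 1) := Real.rpow_pos_of_pos hspos _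
    rw [hmul s₀ hspos] at h2
    have h4 : s₀ ^ (k - 1) * (k * (u x₀ s₀ + δ) + s₀ * (u x₀ s₀ ^ γ *
        ‖fderiv ℝ (fun y => u y s₀) x₀‖ ^ β *
      (σ ^ 2 / (2 * a) * Laplacian.laplacian (fun y => u y s₀) x₀
        - De / a * ∑ i : Fin d, fderiv ℝ (fun y => u y s₀) x₀ (EuclideanSpace.single i 1)))) ≤
        s₀ ^ (k - 1) * 0 := by
      linarith
    have h5 := le_of_mul_le_mul_left h4 hsk1
    rw [le_neg, div_le_iff₀ (by positivity)]
    rw [hk] at h5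
    have h6 : (γ + β) * (1 / (γ + β) * (u x₀ s₀ + δ)) = u x₀ s₀ + δ := by field_simp
    nlinarith [mul_le_mul_of_nonneg_left h5 hm.le]
  · have h1 := (hkd t₀ htpos).mul hdt
    have h2 := h1.nonneg_of_eventually_le (by
      filter_upwards [Ioo_mem_nhdsLT htpos] with t ht
      have h3 := hle x₀ t s₀ ⟨hx₀, ht.1.le, by simp only; linarith [ht.2], hωs₀, hs₀⟩
      simp only [Pi.mul_apply]
      rw [heq]
      exact h3)
    have hnorm : Λ * ‖fderiv ℝ (fun y => u y s₀) x₀‖ = ‖fderiv ℝ (fun y => u y t₀) x₀‖ := by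
      rw [hfd, norm_smul, Real.norm_of_nonneg hΛ0.le]
    rw [hnorm]
    exact neg_div_le_of_deriv_rpow_mul_nonneg hm htpos h2

/-- The Bénilan–Crandall inequality: `t ^ (1 / (γ + β)) * u` is nondecreasing in time. -/
theorem rpow_mul_monotone (h : IsClassicalSolution U T a σ De γ β u₀ u) (hU : IsOpen U)
    (hUb : Bornology.IsBounded U) (ha : 0 < a) (hγ : 0 < γ) (hβ : 0 ≤ β)
    {x : Space d} (hx : x ∈ U) {t s : ℝ} (ht : 0 < t) (hts : t ≤ s) (hs : s ≤ T) :
    t ^ (1 / (γ + β)) * u x t ≤ s ^ (1 / (γ + β)) * u x s := by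
  have hs0 : 0 < s ^ (1 / (γ + β)) := Real.rpow_pos_of_pos (ht.trans_le hts) _
  refine le_of_forall_pos_le_add fun ε hε => ?_
  have h1 := h.rpow_mul_le_rpow_mul_add hU hUb ha hγ hβ (div_pos hε hs0) hx ht hts hs
  rwa [mul_add, mul_div_cancel₀ _ hs0.ne'] at h1

/-- At each time the solution satisfies a one-sided elliptic differential inequality. -/
theorem elliptic_inequality (h : IsClassicalSolution U T a σ De γ β u₀ u) (hU : IsOpen U)
    (hUb : Bornology.IsBounded U) (ha : 0 < a) (hγ : 0 < γ) (hβ : 0 ≤ β)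
    {x : Space d} (hx : x ∈ U) {t : ℝ} (ht : t ∈ Set.Ioc 0 T) :
    -(u x t / ((γ + β) * t)) ≤ u x t ^ γ * ‖fderiv ℝ (fun y => u y t) x‖ ^ β *
      (σ ^ 2 / (2 * a) * Laplacian.laplacian (fun y => u y t) x
        - De / a * ∑ i : Fin d, fderiv ℝ (fun y => u y t) x (EuclideanSpace.single i 1)) := by
  have hm : 0 < γ + β := by linarith
  have htpos := ht.1
  have hd := h.hasDerivWithinAt hx ht
  set k : ℝ := 1 / (γ + β) with hk
  have hk0 : 0 < k := by positivity
  have h1 := (Real.hasDerivAt_rpow_const (p := k) (Or.inl ht.1.ne')).hasDerivWithinAt.mul hd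
  have h2 := h1.nonneg_of_eventually_le (by
    filter_upwards [Ioo_mem_nhdsLT ht.1] with s hs
    exact h.rpow_mul_monotone hU hUb ha hγ hβ hx hs.1 hs.2.le ht.2)
  exact neg_div_le_of_deriv_rpow_mul_nonneg hm ht.1 h2

end IsClassicalSolution

/-! ### Measure estimate by sliding cusps -/

/-- A continuous endomorphism of a Euclidean space has determinant at most `‖A‖ ^ d`. -/
theorem abs_det_le_opNorm_pow {d : ℕ} (A : Space d →L[ℝ] Space d) : |A.det| ≤ ‖A‖ ^ d := by
  have h1 := MeasureTheory.Measure.addHaar_image_continuousLinearMap MeasureTheory.volume A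
    (Metric.ball 0 1)
  have h2 : A '' Metric.ball 0 1 ⊆ Metric.closedBall 0 ‖A‖ := by
    rintro _ ⟨x, hx, rfl⟩
    rw [mem_ball_zero_iff] at hx
    rw [mem_closedBall_zero_iff]
    calc ‖A x‖ ≤ ‖A‖ * ‖x‖ := A.le_opNorm x
      _ ≤ ‖A‖ * 1 := by gcongr
      _ = ‖A‖ := mul_one _
  have h3 := MeasureTheory.measure_mono (μ := MeasureTheory.volume) h2
  rw [h1, MeasureTheory.Measure.addHaar_closedBall _ _ (norm_nonneg A),
    finrank_euclideanSpace_fin] at h3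
  have hpos : MeasureTheory.volume (Metric.ball (0 : Space d) 1) ≠ 0 :=
    (Metric.measure_ball_pos _ _ one_pos).ne'
  have hfin : MeasureTheory.volume (Metric.ball (0 : Space d) 1) ≠ ⊤ :=
    MeasureTheory.measure_ball_lt_top.ne
  rw [ENNReal.mul_le_mul_iff_left hpos hfin, ENNReal.ofReal_le_ofReal_iff (by positivity)] at h3
  exact h3

/-- A symmetric bilinear form that is bounded above and whose trace is bounded below has bounded
norm. -/
theorem opNorm_le_of_le_of_trace_ge {d : ℕ} (H : Space d →L[ℝ] Space d →L[ℝ] ℝ)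
    (hsymm : ∀ v w, H v w = H w v) {Q C : ℝ} (hQ0 : 0 ≤ Q) (hC : 0 ≤ C)
    (hQ : ∀ v, H v v ≤ Q * ‖v‖ ^ 2)
    (htr : -C ≤ ∑ i : Fin d, H (EuclideanSpace.single i 1) (EuclideanSpace.single i 1)) :
    ‖H‖ ≤ Q + (d * Q + C) := by
  -- `Q⟨·,·⟩ - H` is positive semidefinite, so its norm is at most its trace, and the trace is
  -- bounded by `dQ + C`.
  set P : LinearMap.BilinForm ℝ (Space d) :=
    Q • (innerₗ (Space d)) - H.toLinearMap₁₂ with hP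
  have hPa : ∀ v w, P v w = Q * inner ℝ v w - H v w := fun v w => by
    simp [hP]
  have hPs : ∀ v w, P v w = P w v := fun v w => by
    rw [hPa, hPa, hsymm v w, real_inner_comm]
  have hPpos : ∀ v, 0 ≤ P v v := fun v => by
    rw [hPa, real_inner_self_eq_norm_sq]; linarith [hQ v]
  set e : Fin d → Space d := fun i => EuclideanSpace.single i 1 with he
  set τ : ℝ := ∑ i, P (e i) (e i) with hτ
  have hτ0 : 0 ≤ τ := Finset.sum_nonneg fun i _ => hPpos _
  have hτle : τ ≤ d * Q + C := by
    have h1 : τ = ∑ i : Fin d, (Q - H (e i) (e i)) := by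
      refine Finset.sum_congr rfl fun i _ => ?_
      rw [hPa, real_inner_self_eq_norm_sq]; simp [he]
    rw [h1, Finset.sum_sub_distrib]
    simp only [Finset.sum_const, Finset.card_univ, Fintype.card_fin, nsmul_eq_mul]
    linarith
  have hvle : ∀ v, P v v ≤ ‖v‖ ^ 2 * τ := by
    intro v
    have hv : v = ∑ i, v i • e i := by
      have := (EuclideanSpace.basisFun (Fin d) ℝ).sum_repr v
      simpa [he] using this.symm
    have h1 : P v v = ∑ i, ∑ j, v i * v j * P (e i) (e j) := by
      conv_lhs => rw [hv]
      simp only [map_sum, map_smul, LinearMap.sum_apply, LinearMap.smul_apply, smul_eq_mul]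
      refine Finset.sum_congr rfl fun i _ => ?_
      rw [Finset.mul_sum]
      refine Finset.sum_congr rfl fun j _ => ?_
      rw [hPs (e j) (e i)]; ring
    have h2 : ∀ i j, 2 * (v i * v j * P (e i) (e j)) ≤
        v i ^ 2 * P (e j) (e j) + v j ^ 2 * P (e i) (e i) := by
      intro i j
      -- Positivity on these vectors, summed over `i` and `j`, gives `P v v ≤ |v|² tr P`.
      have h3 := hPpos (v i • e j - v j • e i)
      simp only [map_sub, map_smul, LinearMap.sub_apply, LinearMap.smul_apply, smul_eq_mul] at h3
      rw [hPs (e j) (e i)] at h3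
      linarith
    have h4 : 2 * P v v ≤ ∑ i, ∑ j, (v i ^ 2 * P (e j) (e j) + v j ^ 2 * P (e i) (e i)) := by
      rw [h1, Finset.mul_sum]
      refine Finset.sum_le_sum fun i _ => ?_
      rw [Finset.mul_sum]
      exact Finset.sum_le_sum fun j _ => h2 i j
    have h5 : ∑ i, ∑ j, (v i ^ 2 * P (e j) (e j) + v j ^ 2 * P (e i) (e i)) =
        2 * ((∑ i, v i ^ 2) * τ) := by
      simp only [Finset.sum_add_distrib]
      rw [Finset.sum_comm (f := fun i j => v j ^ 2 * P (e i) (e i)), ← two_mul, Finset.sum_mul]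
      simp only [hτ, Finset.mul_sum]
    have h6 : ‖v‖ ^ 2 = ∑ i, v i ^ 2 := by
      rw [EuclideanSpace.norm_sq_eq]; simp
    rw [h6]
    linarith
  have hPP : ∀ v w, |P v w| ≤ τ * ‖v‖ * ‖w‖ := by
    intro v w
    refine abs_le_of_sq_le_sq ?_ (by positivity)
    have h1 := P.apply_mul_apply_le_of_forall_zero_le hPpos v w
    rw [hPs w v] at h1
    calc P v w ^ 2 = P v w * P v w := sq _
      _ ≤ P v v * P w w := h1
      _ ≤ (‖v‖ ^ 2 * τ) * (‖w‖ ^ 2 * τ) :=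
          mul_le_mul (hvle v) (hvle w) (hPpos w) (by positivity)
      _ = _ := by ring
  refine H.opNorm_le_bound₂ (by positivity) fun v w => ?_
  have h1 : H v w = Q * inner ℝ v w - P v w := by rw [hPa]; ring
  rw [h1, Real.norm_eq_abs]
  have hn : 0 ≤ ‖v‖ * ‖w‖ := by positivity
  calc |Q * inner ℝ v w - P v w| ≤ |Q * inner ℝ v w| + |P v w| := abs_sub _ _
    _ ≤ Q * (‖v‖ * ‖w‖) + τ * ‖v‖ * ‖w‖ := by
        rw [abs_mul, abs_of_nonneg hQ0]
        gcongr
        · exact abs_real_inner_le_norm v w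
        · exact hPP v w
    _ = (Q + τ) * (‖v‖ * ‖w‖) := by ring
    _ ≤ (Q + (d * Q + C)) * (‖v‖ * ‖w‖) := by gcongr
    _ = _ := by ring

/-- Critical points of the touched function must not be excluded from the vertex map. At `p = 0`
with `β > 0` the map is `o(p)`, so its derivative there is zero. -/
theorem exists_hasFDerivAt_norm_rpow_smul {E : Type*} [NormedAddCommGroup E]
    [InnerProductSpace ℝ E] {β : ℝ} (hβ : 0 ≤ β) (p : E) :
    ∃ L : E →L[ℝ] E, HasFDerivAt (fun p : E => ‖p‖ ^ β • p) L p ∧ ‖L‖ ≤ (1 + β) * ‖p‖ ^ β := by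
  rcases hβ.eq_or_lt with rfl | hβ
  · refine ⟨ContinuousLinearMap.id ℝ E, ?_, ?_⟩
    · simp only [Real.rpow_zero, one_smul]
      exact hasFDerivAt_id p
    · simpa using ContinuousLinearMap.norm_id_le
  by_cases hp : p = 0
  · subst hp
    refine ⟨0, ?_, by simp [Real.zero_rpow hβ.ne']⟩
    rw [hasFDerivAt_iff_isLittleO_nhds_zero]
    simp only [zero_add, norm_zero, smul_zero, sub_zero, zero_apply]
    have h1 : (fun h : E => ‖h‖ ^ β) =o[nhds 0] (fun _ => (1 : ℝ)) := by
      rw [Asymptotics.isLittleO_one_iff]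
      have h2 : ContinuousAt (fun h : E => ‖h‖ ^ β) 0 :=
        continuousAt_id.norm.rpow_const (Or.inr hβ.le)
      have h3 := h2.tendsto
      simpa [Real.zero_rpow hβ.ne'] using h3
    have := h1.smul_isBigO (Asymptotics.isBigO_refl (fun h : E => h) (nhds 0))
    simpa using this
  · have hn : 0 < ‖p‖ := norm_pos_iff.mpr hp
    have h1 : HasFDerivAt (fun x : E => ‖x‖ ^ β) ((β * ‖p‖ ^ (β - 2)) • innerSL ℝ p) p := by
      apply HasStrictFDerivAt.hasFDerivAt
      convert! (hasStrictFDerivAt_norm_sq p).rpow_const (p := β / 2) (by simp [hp]) using 0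
      simp_rw [← Real.rpow_natCast_mul (norm_nonneg _), ← Nat.cast_smul_eq_nsmul ℝ, smul_smul]
      ring_nf
    refine ⟨_, h1.smul (hasFDerivAt_id p), ?_⟩
    refine (norm_add_le _ _).trans ?_
    have h2 : ‖‖p‖ ^ β • ContinuousLinearMap.id ℝ E‖ ≤ ‖p‖ ^ β := by
      rw [norm_smul, Real.norm_of_nonneg (by positivity)]
      exact mul_le_of_le_one_right (by positivity) ContinuousLinearMap.norm_id_le
    have h3 : ‖((β * ‖p‖ ^ (β - 2)) • innerSL ℝ p).smulRight (id p)‖ ≤ β * ‖p‖ ^ β := by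
      rw [ContinuousLinearMap.norm_smulRight_apply, norm_smul, innerSL_apply_norm,
        Real.norm_of_nonneg (by positivity)]
      have : ‖p‖ ^ β = ‖p‖ ^ (β - 2) * ‖p‖ * ‖p‖ := by
        rw [← Real.rpow_add_one hn.ne', ← Real.rpow_add_one hn.ne']; ring_nf
      rw [this]
      simp only [id]
      exact le_of_eq (by ring)
    simp only [id] at h3 ⊢
    linarith

theorem hasFDerivAt_gradient {d : ℕ} {f : Space d → ℝ} {x : Space d} (hf : ContDiffAt ℝ 2 f x) :
    ∃ G : Space d →L[ℝ] Space d, HasFDerivAt (gradient f) G x ∧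
      ‖G‖ ≤ ‖fderiv ℝ (fderiv ℝ f) x‖ := by
  have hff : DifferentiableAt ℝ (fderiv ℝ f) x :=
    (hf.fderiv_right (m := 1) (by norm_num)).differentiableAt (by simp)
  set J : StrongDual ℝ (Space d) →L[ℝ] Space d :=
    (InnerProductSpace.toDual ℝ (Space d)).symm.toLinearIsometry.toContinuousLinearMap with hJ
  refine ⟨J.comp (fderiv ℝ (fderiv ℝ f) x), J.hasFDerivAt.comp x hff.hasFDerivAt, ?_⟩
  refine ContinuousLinearMap.opNorm_le_bound _ (norm_nonneg (fderiv ℝ (fderiv ℝ f) x)) fun v => ?_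
  have h1 : ‖J (fderiv ℝ (fderiv ℝ f) x v)‖ = ‖fderiv ℝ (fderiv ℝ f) x v‖ :=
    (InnerProductSpace.toDual ℝ (Space d)).symm.norm_map _
  rw [ContinuousLinearMap.comp_apply, h1]
  exact (fderiv ℝ (fderiv ℝ f) x).le_opNorm v

theorem norm_smul_clm {E F : Type*} [NormedAddCommGroup E] [NormedSpace ℝ E]
    [NormedAddCommGroup F] [NormedSpace ℝ F] {κ : ℝ} (h : 0 ≤ κ) (H : E →L[ℝ] F) :
    ‖κ • H‖ = κ * ‖H‖ := by
  rw [norm_smul, Real.norm_of_nonneg h]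

/-- The map sending a contact point to the vertex of the touching cusp. -/
noncomputable def vertexMap {d : ℕ} (β c : ℝ) (f : Space d → ℝ) (x : Space d) : Space d :=
  x - c • (‖gradient f x‖ ^ β • gradient f x)

/-- By the chain rule the Hessian enters only through `κ D²f` with `κ = c|∇f|^β`, up to the factor
`1 + β`. This weighted Hessian is at most the identity by contact and has trace at least `-C`, so
its norm is controlled without any lower bound on `|∇f|`. -/
theorem vertexMap_fderiv_bound {d : ℕ} {f : Space d → ℝ} {x : Space d} {β c C : ℝ}
    (hβ : 0 ≤ β) (hc : 0 ≤ c) (hC : 0 ≤ C) (hf : ContDiffAt ℝ 2 f x)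
    (hup : ∀ v, c * ‖fderiv ℝ f x‖ ^ β * fderiv ℝ (fderiv ℝ f) x v v ≤ ‖v‖ ^ 2)
    (hlow : -C ≤ c * ‖fderiv ℝ f x‖ ^ β * Laplacian.laplacian f x) :
    DifferentiableAt ℝ (vertexMap β c f) x ∧
      ‖fderiv ℝ (vertexMap β c f) x‖ ≤ 1 + (1 + β) * (1 + (d + C)) := by
  obtain ⟨G, hG, hGn⟩ := hasFDerivAt_gradient hf
  obtain ⟨L, hL, hLn⟩ := exists_hasFDerivAt_norm_rpow_smul hβ (gradient f x)
  have hcomp : HasFDerivAt (fun x => ‖gradient f x‖ ^ β • gradient f x) (L.comp G) x :=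
    hL.comp x hG
  have hΨ : HasFDerivAt (vertexMap β c f) (ContinuousLinearMap.id ℝ _ - c • L.comp G) x :=
    (hasFDerivAt_id x).sub (hcomp.const_smul c)
  refine ⟨hΨ.differentiableAt, ?_⟩
  rw [hΨ.fderiv]
  set κ := c * ‖fderiv ℝ f x‖ ^ β with hκ
  have hκ0 : 0 ≤ κ := by positivity
  have hsymm : IsSymmSndFDerivAt ℝ f x := hf.isSymmSndFDerivAt (by simp)
  have hH : ‖κ • fderiv ℝ (fderiv ℝ f) x‖ ≤ 1 + (d * 1 + C) := by
    refine opNorm_le_of_le_of_trace_ge _ (fun v w => ?_) zero_le_one hC (fun v => ?_) ?_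
    · simp only [smul_apply, smul_eq_mul]
      rw [hsymm.eq v w]
    · simpa using hup v
    · rw [laplacian_eq_sum_fderiv_fderiv, Finset.mul_sum] at hlow
      simpa using hlow
  rw [norm_smul_clm hκ0] at hH
  refine (norm_sub_le _ _).trans ?_
  have h1 : ‖c • L.comp G‖ ≤ (1 + β) * (1 + (d + C)) := by
    rw [norm_smul, Real.norm_of_nonneg hc]
    calc c * ‖L.comp G‖ ≤ c * (‖L‖ * ‖G‖) := by gcongr; exact L.opNorm_comp_le G
      _ ≤ c * (((1 + β) * ‖gradient f x‖ ^ β) * ‖fderiv ℝ (fderiv ℝ f) x‖) := by gcongr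
      _ = (1 + β) * (κ * ‖fderiv ℝ (fderiv ℝ f) x‖) := by rw [norm_gradient_eq, hκ]; ring
      _ ≤ (1 + β) * (1 + (d * 1 + C)) := by gcongr
      _ = _ := by ring
  linarith [ContinuousLinearMap.norm_id_le (𝕜 := ℝ) (E := Space d)]

/-- Concavity of `z ↦ z^(α/2)`, with tangent at `z = N²`. It replaces the cusp by a paraboloid lying
above it and touching it at distance `N`. -/
theorem norm_rpow_le_quadratic {s N α : ℝ} (hN : 0 < N) (hs : 0 ≤ s) (hα0 : 0 ≤ α) (hα2 : α ≤ 2) :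
    s ^ α ≤ N ^ α + α / 2 * N ^ (α - 2) * (s ^ 2 - N ^ 2) := by
  have h1 := rpow_one_add_le_one_add_mul_self (s := s ^ 2 / N ^ 2 - 1) (p := α / 2)
    (by have : 0 ≤ s ^ 2 / N ^ 2 := by positivity
        linarith) (by linarith) (by linarith)
  have h2 : (1 + (s ^ 2 / N ^ 2 - 1)) ^ (α / 2) = s ^ α / N ^ α := by
    rw [add_sub_cancel, ← div_pow, ← Real.rpow_natCast_mul (by positivity),
      Real.div_rpow hs hN.le]
    simp [mul_div_cancel₀]
  have hNα : 0 < N ^ α := Real.rpow_pos_of_pos hN _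
  rw [h2, div_le_iff₀ hNα] at h1
  have h3 : N ^ α = N ^ (α - 2) * N ^ 2 := by
    rw [← Real.rpow_natCast, ← Real.rpow_add hN]; norm_num
  calc s ^ α ≤ (1 + α / 2 * (s ^ 2 / N ^ 2 - 1)) * N ^ α := h1
    _ = N ^ α + α / 2 * (s ^ 2 / N ^ 2 - 1) * N ^ α := by ring
    _ = N ^ α + α / 2 * (s ^ 2 / N ^ 2 - 1) * (N ^ (α - 2) * N ^ 2) := by rw [← h3]
    _ = _ := by field_simp

/-- Contact from above with `A ‖· - y‖ ^ ((β + 2) / (β + 1))`. -/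
theorem cusp_contact {d : ℕ} {f : Space d → ℝ} {x y : Space d} {β A : ℝ} (hβ : 0 ≤ β)
    (hA : 0 < A) (hf : ContDiffAt ℝ 2 f x)
    (hmax : IsLocalMax (fun x' => f x' - A * ‖x' - y‖ ^ ((β + 2) / (β + 1))) x)
    {c : ℝ} (hc : c = (A * ((β + 2) / (β + 1))) ^ (-(β + 1))) :
    vertexMap β c f x = y ∧
      (∀ v, c * ‖fderiv ℝ f x‖ ^ β * fderiv ℝ (fderiv ℝ f) x v v ≤ ‖v‖ ^ 2) ∧
      c * ‖fderiv ℝ f x‖ ^ β * ‖fderiv ℝ f x‖ = ‖x - y‖ := by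
  set α : ℝ := (β + 2) / (β + 1) with hα
  have hα1 : 1 < α := by rw [hα, lt_div_iff₀ (by linarith)]; linarith
  have hα2 : α ≤ 2 := by rw [hα, div_le_iff₀ (by linarith)]; linarith
  have hAα : 0 < A * α := by positivity
  have hc0 : 0 < c := by rw [hc]; exact Real.rpow_pos_of_pos hAα _
  -- For `β > 0` the cusp is not `C²` at its vertex. Contact there still forces `∇f = 0`, and then
  -- the weight `|∇f|^β` vanishes. In the other case either `x ≠ y`, or `β = 0` and the cusp is a
  -- paraboloid.
  by_cases hcase : x - y = 0 ∧ 0 < β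
  · obtain ⟨hxy, hβ'⟩ := hcase
    have hxy' : x = y := sub_eq_zero.mp hxy
    have hg : HasFDerivAt (fun x' : Space d => A * ‖x' - y‖ ^ α) (0 : Space d →L[ℝ] ℝ) x := by
      have h1 : HasFDerivAt (fun x' : Space d => ‖x' - y‖ ^ α)
          ((α * ‖x - y‖ ^ (α - 2)) • innerSL ℝ (x - y)) x :=
        HasFDerivAt.comp (g := fun z : Space d => ‖z‖ ^ α) (f := fun x' : Space d => x' - y) x
          (hasFDerivAt_norm_rpow (x - y) hα1) ((hasFDerivAt_id x).sub_const y)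
      have h2 := h1.const_mul A
      rw [hxy] at h2
      simpa using h2
    have h3 := hmax.hasFDerivAt_eq_zero ((hf.differentiableAt (by simp)).hasFDerivAt.sub hg)
    rw [sub_zero] at h3
    have h4 : gradient f x = 0 := by simp [gradient, h3]
    refine ⟨?_, fun v => ?_, ?_⟩
    · rw [vertexMap, h4]; simp [hxy']
    · rw [h3, norm_zero, Real.zero_rpow hβ'.ne']; simp
    · rw [h3, hxy]; simp
  · set N := ‖x - y‖ with hN
    have hN0 : 0 ≤ N := norm_nonneg _
    set κ := A * α * N ^ (α - 2) with hκ
    have hquad : ∀ x' : Space d, ‖x' - y‖ ^ α ≤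
        N ^ α + α / 2 * N ^ (α - 2) * (‖x' - y‖ ^ 2 - N ^ 2) := by
      intro x'
      rcases hN0.eq_or_lt with h0 | h0
      · have hβ0 : β = 0 := by
          by_contra hne
          exact hcase ⟨norm_eq_zero.mp (by rw [← hN, ← h0]), lt_of_le_of_ne hβ (Ne.symm hne)⟩
        have hα' : α = 2 := by rw [hα, hβ0]; norm_num
        rw [← h0, hα']
        norm_num
      · exact norm_rpow_le_quadratic h0 (norm_nonneg _) (by linarith) hα2
    -- This identity fixes the cusp exponent: `(α - 2)(β + 1) + β = 0`, so one constant `c` serves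
    -- all distances `N`.
    have hκN : c * κ ^ (β + 1) * N ^ β = 1 := by
      rcases hN0.eq_or_lt with h0 | h0
      · have hβ0 : β = 0 := by
          by_contra hne
          exact hcase ⟨norm_eq_zero.mp (by rw [← hN, ← h0]), lt_of_le_of_ne hβ (Ne.symm hne)⟩
        have hα' : α = 2 := by rw [hα, hβ0]; norm_num
        rw [hc, hκ, ← h0, hα', hβ0]
        norm_num [Real.rpow_neg_one]
        field_simp
      · rw [hc, hκ, Real.mul_rpow hAα.le (by positivity), ← mul_assoc, ← Real.rpow_add hAα,
          neg_add_cancel, Real.rpow_zero, one_mul, ← Real.rpow_mul h0.le, ← Real.rpow_add h0]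
        have : (α - 2) * (β + 1) + β = 0 := by rw [hα]; field_simp; ring
        rw [this, Real.rpow_zero]
    have hκ0 : 0 < κ := by
      by_contra hneg
      have h0 : κ = 0 := le_antisymm (not_lt.mp hneg) (by positivity)
      rw [h0, Real.zero_rpow (by linarith)] at hκN
      simp at hκN
    set g : Space d → ℝ := fun x' => A * (N ^ α + α / 2 * N ^ (α - 2) * (‖x' - y‖ ^ 2 - N ^ 2))
      with hg
    have hgd : ∀ x', HasFDerivAt g (κ • innerSL ℝ (x' - y)) x' := by
      intro x'
      have h1 : HasFDerivAt (fun x' : Space d => ‖x' - y‖ ^ 2) (2 • innerSL ℝ (x' - y)) x' := by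
        exact (hasStrictFDerivAt_norm_sq (x' - y)).hasFDerivAt.comp x'
          ((hasFDerivAt_id x').sub_const y)
      refine (((((h1.sub_const (N ^ 2)).const_mul (α / 2 * N ^ (α - 2))).const_add
        (N ^ α)).const_mul A)).congr_fderiv ?_
      ext v
      simp [hκ]
      ring
    have hgcd : ContDiffAt ℝ 2 g x := by
      have h1 : ContDiff ℝ 2 fun x' : Space d => ‖x' - y‖ ^ 2 :=
        (contDiff_id.sub contDiff_const).norm_sq ℝ
      exact (contDiff_const.mul (contDiff_const.add
        (contDiff_const.mul (h1.sub contDiff_const)))).contDiffAt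
    have hloc : IsLocalMax (fun x' => f x' - g x') x := by
      filter_upwards [hmax] with x' hx'
      have h1 : A * ‖x' - y‖ ^ α ≤ g x' := mul_le_mul_of_nonneg_left (hquad x') hA.le
      have h2 : g x = A * ‖x - y‖ ^ α := by simp [hg, ← hN]
      linarith
    obtain ⟨h1, -, h2⟩ := contact_conditions hloc hf hgcd
    rw [(hgd x).fderiv] at h1
    have hgg : ∀ v, fderiv ℝ (fderiv ℝ g) x v v = κ * ‖v‖ ^ 2 := by
      intro v
      have h3 : fderiv ℝ g = fun x' => κ • innerSL ℝ (x' - y) := funext fun x' => (hgd x').fderiv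
      have h4 : HasFDerivAt (fun x' : Space d => κ • innerSL ℝ (x' - y)) (κ • innerSL ℝ) x :=
        ((innerSL ℝ).hasFDerivAt.comp x ((hasFDerivAt_id x).sub_const y)).const_smul κ
      rw [h3, h4.fderiv]
      simp only [smul_apply, smul_eq_mul]
      exact congrArg (κ * ·) (real_inner_self_eq_norm_sq v)
    have hgrad : gradient f x = κ • (x - y) := by
      rw [gradient, h1]
      rw [map_smul]
      congr 1
      rw [LinearIsometryEquiv.symm_apply_eq]
      rfl
    have hpn : ‖fderiv ℝ f x‖ = κ * N := by
      rw [h1, norm_smul, innerSL_apply_norm, Real.norm_of_nonneg hκ0.le]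
    have hckey : c * ‖fderiv ℝ f x‖ ^ β * κ = 1 := by
      rw [hpn, Real.mul_rpow hκ0.le hN0, ← hκN, Real.rpow_add_one hκ0.ne']
      ring
    refine ⟨?_, fun v => ?_, ?_⟩
    · rw [vertexMap, norm_gradient_eq, hgrad, smul_smul, smul_smul, hckey, one_smul,
        sub_sub_cancel]
    · have h5 := h2 v
      rw [hgg] at h5
      calc c * ‖fderiv ℝ f x‖ ^ β * fderiv ℝ (fderiv ℝ f) x v v
          ≤ c * ‖fderiv ℝ f x‖ ^ β * (κ * ‖v‖ ^ 2) := by gcongr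
        _ = c * ‖fderiv ℝ f x‖ ^ β * κ * ‖v‖ ^ 2 := by ring
        _ = ‖v‖ ^ 2 := by rw [hckey, one_mul]
    · calc c * ‖fderiv ℝ f x‖ ^ β * ‖fderiv ℝ f x‖
          = c * ‖fderiv ℝ f x‖ ^ β * κ * N := by rw [mul_assoc _ κ N, ← hpn]
        _ = N := by rw [hckey, one_mul]

/-- The elliptic inequality is multiplied by `c / v^γ`. The intrinsic scaling `ρ^(β+2) ≤ M^(γ+β) t`
gives `c ≤ M^(γ-1) t`, which bounds the zero-order term independently of `M` and `t`. The drift is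
bounded because `c p^(β+1)`, the distance from contact point to vertex, is at most `2Rm`. -/
theorem laplacian_lower_bound_of_contact {D B γ β K Rm M ρ t c p v lap S n : ℝ} (hD : 0 < D)
    (hγ : 0 < γ) (hβ : 0 ≤ β) (hK : 1 ≤ K) (hM : 0 < M) (ht : 0 < t)
    (hc : 0 < c) (hp : 0 ≤ p) (hn : 0 ≤ n) (hρ' : ρ ^ (β + 2) ≤ M ^ (γ + β) * t)
    (hcM : c ≤ M ^ (-(β + 1)) * ρ ^ (β + 2)) (hcp : c * p ^ β * p ≤ 2 * Rm)
    (hS : |S| ≤ n * p) (hv : M / 2 ≤ v) (hv' : v ≤ K * M)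
    (hell : -(v / ((γ + β) * t)) ≤ v ^ γ * p ^ β * (D * lap - B * S)) :
    -((K * 2 ^ γ / (γ + β) + |B| * n * (2 * Rm)) / D) ≤ c * p ^ β * lap := by
  have hm : 0 < γ + β := by linarith
  have hv0 : 0 < v := by linarith
  have hvγ : 0 < v ^ γ := Real.rpow_pos_of_pos hv0 _
  have hMγ : 0 < M ^ γ := Real.rpow_pos_of_pos hM _
  have h2γ : (0 : ℝ) < 2 ^ γ := Real.rpow_pos_of_pos two_pos _
  have hpb : 0 ≤ p ^ β := Real.rpow_nonneg hp _
  have h1 : M ^ γ / 2 ^ γ ≤ v ^ γ := by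
    rw [← Real.div_rpow hM.le two_pos.le]
    exact Real.rpow_le_rpow (by positivity) hv hγ.le
  have h2 : -(v / ((γ + β) * t * v ^ γ)) ≤ p ^ β * (D * lap - B * S) := by
    have : -(v / ((γ + β) * t)) / v ^ γ ≤ p ^ β * (D * lap - B * S) := by
      rw [div_le_iff₀ hvγ]; linarith
    refine le_trans (le_of_eq ?_) this
    field_simp
  have h3 : v / ((γ + β) * t * v ^ γ) ≤ K * M / ((γ + β) * t * (M ^ γ / 2 ^ γ)) := by
    gcongr
  have h4 : c ≤ M ^ (γ + β) * t * M ^ (-(β + 1)) := by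
    calc c ≤ M ^ (-(β + 1)) * ρ ^ (β + 2) := hcM
      _ ≤ M ^ (-(β + 1)) * (M ^ (γ + β) * t) := by gcongr
      _ = _ := by ring
  have h5 : M ^ (γ + β) * M ^ (-(β + 1)) * M = M ^ γ := by
    rw [← Real.rpow_add hM, ← Real.rpow_add_one hM.ne']; ring_nf
  have h6 : c * (K * M / ((γ + β) * t * (M ^ γ / 2 ^ γ))) ≤ K * 2 ^ γ / (γ + β) := by
    calc c * (K * M / ((γ + β) * t * (M ^ γ / 2 ^ γ)))
        ≤ (M ^ (γ + β) * t * M ^ (-(β + 1))) * (K * M / ((γ + β) * t * (M ^ γ / 2 ^ γ))) := by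
          gcongr
      _ = (M ^ (γ + β) * M ^ (-(β + 1)) * M) * (K * 2 ^ γ / ((γ + β) * M ^ γ)) := by
          field_simp
      _ = K * 2 ^ γ / (γ + β) := by rw [h5]; field_simp
  have h7 : -(K * 2 ^ γ / (γ + β)) ≤ c * (p ^ β * (D * lap - B * S)) := by
    calc -(K * 2 ^ γ / (γ + β)) ≤ c * -(K * M / ((γ + β) * t * (M ^ γ / 2 ^ γ))) := by linarith
      _ ≤ _ := by gcongr; linarith
  have h8 : -(|B| * n * (2 * Rm)) ≤ c * p ^ β * (B * S) := by
    have : |c * p ^ β * (B * S)| ≤ |B| * n * (2 * Rm) := by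
      rw [abs_mul, abs_mul B, abs_of_nonneg (by positivity : 0 ≤ c * p ^ β)]
      calc c * p ^ β * (|B| * |S|) ≤ c * p ^ β * (|B| * (n * p)) := by gcongr
        _ = |B| * n * (c * p ^ β * p) := by ring
        _ ≤ _ := by gcongr
    exact (abs_le.mp this).1
  rw [← neg_div, div_le_iff₀ hD]
  linarith

/-- A subsolution of the elliptic inequality that is comparable to its value `M` at the centre of
a ball exceeds `M / 2` on a fixed portion of that ball. -/
theorem exists_volume_superlevel_ge (d : ℕ) {D B γ β K Rm : ℝ} (hD : 0 < D) (hγ : 0 < γ)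
    (hβ : 0 ≤ β) (hK : 1 ≤ K) (hRm : 0 < Rm) :
    ∃ c : ℝ, 0 < c ∧ ∀ (U : Set (Space d)) (f : Space d → ℝ) (x₀ : Space d) (ρ M t : ℝ),
      IsOpen U → ContinuousOn f (closure U) → (∀ x ∈ frontier U, f x = 0) →
      (∀ x ∈ U, ContDiffAt ℝ 2 f x) →
      (∀ x ∈ U, -(f x / ((γ + β) * t)) ≤ f x ^ γ * ‖fderiv ℝ f x‖ ^ β *
        (D * Laplacian.laplacian f x
          - B * ∑ i : Fin d, fderiv ℝ f x (EuclideanSpace.single i 1))) →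
      0 < ρ → ρ ≤ Rm → 0 < M → 0 < t → x₀ ∈ U → f x₀ = M →
      (∀ x ∈ U, ‖x - x₀‖ ≤ ρ → f x ≤ K * M) → ρ ^ (β + 2) ≤ M ^ (γ + β) * t →
      ENNReal.ofReal (c * ρ ^ d) ≤
        MeasureTheory.volume {x | x ∈ U ∧ ‖x - x₀‖ < ρ ∧ M / 2 ≤ f x} := by
  set C₀ : ℝ := (K * 2 ^ γ / (γ + β) + |B| * d * (2 * Rm)) / D with hC₀
  have hm : 0 < γ + β := by linarith
  have hC₀0 : 0 ≤ C₀ := by positivity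
  set C₁ : ℝ := 1 + (1 + β) * (1 + (d + C₀)) with hC₁
  have hC₁0 : 0 < C₁ := by positivity
  set ω : ℝ := (MeasureTheory.volume (Metric.ball (0 : Space d) 1)).toReal with hω
  have hωtop : MeasureTheory.volume (Metric.ball (0 : Space d) 1) ≠ ⊤ :=
    MeasureTheory.measure_ball_lt_top.ne
  have hω0 : 0 < ω := ENNReal.toReal_pos (Metric.measure_ball_pos _ _ one_pos).ne' hωtop
  -- The volume of the ball of admissible vertices, of radius `ρ/(8K)`, over the Jacobian bound
  -- `C₁^d`, with `ρ^d` factored out.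
  refine ⟨(1 / (8 * K)) ^ d * ω / C₁ ^ d, by positivity, ?_⟩
  intro U f x₀ ρ M t hU hfc hfb hf2 hell hρ hρR hM ht hx₀ hfx₀ hKM hρM
  set α : ℝ := (β + 2) / (β + 1) with hα
  have hα1 : 1 < α := by rw [hα, lt_div_iff₀ (by linarith)]; linarith
  have hα2 : α ≤ 2 := by rw [hα, div_le_iff₀ (by linarith)]; linarith
  -- Extension by zero is continuous, since `f` vanishes on the frontier. The ball may thus leave
  -- `U`, and contact occurs only where `g ≥ M/2`, hence inside `U`.
  set g : Space d → ℝ := U.indicator f with hg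
  have hgc : Continuous g := continuous_indicator hfb hfc
  have hgU : ∀ x ∈ U, g x = f x := fun x hx => Set.indicator_of_mem hx f
  have hgn : ∀ x, x ∉ U → g x = 0 := fun x hx => Set.indicator_of_notMem hx f
  have hgle : ∀ x, ‖x - x₀‖ ≤ ρ → g x ≤ K * M := by
    intro x hx
    by_cases hxU : x ∈ U
    · rw [hgU x hxU]; exact hKM x hxU hx
    · rw [hgn x hxU]; positivity
  have hρα : 0 < ρ ^ α := Real.rpow_pos_of_pos hρ _
  -- At distance `ρ` from its vertex the cusp has height `4KM`, well above the bound `KM` for `g`,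
  -- so the minimum below cannot lie on the sphere. For `|x₀ - y| < ρ/(8K)` its value at `x₀` is at
  -- most `M/2`.
  set A : ℝ := 4 * K * M / ρ ^ α with hA
  have hA0 : 0 < A := by positivity
  have hAρ : A * ρ ^ α = 4 * K * M := by rw [hA, div_mul_cancel₀ _ hρα.ne']
  set c : ℝ := (A * α) ^ (-(β + 1)) with hc
  have hc0 : 0 < c := Real.rpow_pos_of_pos (by positivity) _
  have hcM : c ≤ M ^ (-(β + 1)) * ρ ^ (β + 2) := by
    have h1 : M / ρ ^ α ≤ A * α := by
      rw [hA, div_mul_eq_mul_div]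
      gcongr
      have h2 : 1 ≤ K * α := one_le_mul_of_one_le_of_one_le hK hα1.le
      nlinarith
    calc c ≤ (M / ρ ^ α) ^ (-(β + 1)) :=
          Real.rpow_le_rpow_of_nonpos (by positivity) h1 (by linarith)
      _ = M ^ (-(β + 1)) * ρ ^ (β + 2) := by
          rw [Real.div_rpow hM.le hρα.le, ← Real.rpow_mul hρ.le, div_eq_mul_inv,
            ← Real.rpow_neg hρ.le]
          congr 2
          rw [hα]; field_simp
  set Ψ := vertexMap β c f with hΨ
  set s : Set (Space d) := {x | x ∈ U ∧ ‖x - x₀‖ < ρ ∧ M / 2 ≤ f x} with hs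
  -- Stated through properties of `Ψ` alone, this set is measurable; the exact contact set is never
  -- needed.
  set s' : Set (Space d) := {x | ‖x - x₀‖ < ρ} ∩ {x | M / 2 ≤ g x} ∩
    {x | DifferentiableAt ℝ Ψ x} ∩ {x | ‖fderiv ℝ Ψ x‖ ≤ C₁} with hs'
  have hs's : s' ⊆ s := by
    rintro x ⟨⟨⟨h1, h2⟩, -⟩, -⟩
    have hxU : x ∈ U := by
      by_contra hx
      simp only [Set.mem_ofPred_eq] at h2
      rw [hgn x hx] at h2
      linarith
    refine ⟨hxU, h1, ?_⟩
    rw [← hgU x hxU]; exact h2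
  have hs'm : MeasurableSet s' := by
    refine (((measurableSet_lt (by fun_prop) measurable_const).inter
      (measurableSet_le measurable_const hgc.measurable)).inter
      (measurableSet_of_differentiableAt ℝ Ψ)).inter ?_
    exact measurableSet_le (measurable_fderiv ℝ Ψ).norm measurable_const
  have hcover : Metric.ball x₀ (ρ * (1 / (8 * K))) ⊆ Ψ '' s' := by
    intro y hy
    rw [mem_ball_iff_norm] at hy
    have hθ : 1 / (8 * K) ≤ 1 / 8 := by
      apply one_div_le_one_div_of_le <;> linarith
    have hθ0 : 0 < 1 / (8 * K) := by positivity
    have hαmono : ∀ a : ℝ, 0 ≤ a → a ≤ 1 → a ^ α ≤ a := fun a h0 h1 => by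
      simpa using Real.rpow_le_rpow_of_exponent_ge' h0 h1 zero_le_one hα1.le
    have hF : ContinuousOn (fun x => A * ‖x - y‖ ^ α - g x) (Metric.closedBall x₀ ρ) := by
      refine ContinuousOn.sub (continuousOn_const.mul ?_) hgc.continuousOn
      exact (by fun_prop : Continuous fun x : Space d => ‖x - y‖).continuousOn.rpow_const
        fun _ _ => Or.inr (by linarith)
    obtain ⟨x, hxB, hxmin⟩ := (isCompact_closedBall x₀ ρ).exists_isMinOn
      ⟨x₀, Metric.mem_closedBall_self hρ.le⟩ hF
    rw [mem_closedBall_iff_norm] at hxB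
    have hval : A * ‖x - y‖ ^ α - g x ≤ -(M / 2) := by
      have h1 := hxmin (Metric.mem_closedBall_self hρ.le)
      simp only [Set.mem_ofPred_eq] at h1
      have h2 : A * ‖x₀ - y‖ ^ α ≤ M / 2 := by
        calc A * ‖x₀ - y‖ ^ α ≤ A * (ρ * (1 / (8 * K))) ^ α := by
              gcongr
              rw [norm_sub_rev]; exact hy.le
          _ = A * ρ ^ α * (1 / (8 * K)) ^ α := by
              rw [Real.mul_rpow hρ.le hθ0.le]; ring
          _ ≤ 4 * K * M * (1 / (8 * K)) := by
              rw [hAρ]; gcongr; exact hαmono _ hθ0.le (by linarith)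
          _ = M / 2 := by field_simp; norm_num
      rw [hgU x₀ hx₀, hfx₀] at h1
      linarith
    have hgx : M / 2 ≤ g x := by
      have : 0 ≤ A * ‖x - y‖ ^ α := by positivity
      linarith
    have hxU : x ∈ U := by
      by_contra hx
      rw [hgn x hx] at hgx
      linarith
    have hxint : ‖x - x₀‖ < ρ := by
      refine lt_of_le_of_ne hxB fun heq => ?_
      have h1 : ρ * (7 / 8) ≤ ‖x - y‖ := by
        have h2 : ‖x - x₀‖ ≤ ‖x - y‖ + ‖y - x₀‖ := by
          have := norm_add_le (x - y) (y - x₀)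
          simpa using this
        have h3 : ρ * (1 / (8 * K)) ≤ ρ * (1 / 8) := by gcongr
        linarith
      have h4 : (49 / 64 : ℝ) ≤ (7 / 8) ^ α := by
        have h5 : (7 / 8 : ℝ) ^ (2 : ℝ) ≤ (7 / 8) ^ α :=
          Real.rpow_le_rpow_of_exponent_ge (by norm_num) (by norm_num) hα2
        norm_num at h5 ⊢
        exact h5
      have h6 : 4 * K * M * (49 / 64) ≤ A * ‖x - y‖ ^ α := by
        calc 4 * K * M * (49 / 64) ≤ 4 * K * M * (7 / 8) ^ α := by gcongr
          _ = A * (ρ * (7 / 8)) ^ α := by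
              rw [Real.mul_rpow hρ.le (by norm_num), ← hAρ]; ring
          _ ≤ _ := by gcongr
      have h7 := hgle x hxB
      have h8 : 0 < K * M := by positivity
      nlinarith
    have hloc : IsLocalMax (fun x' => f x' - A * ‖x' - y‖ ^ α) x := by
      have hb : Metric.ball x₀ ρ ∈ nhds x := Metric.isOpen_ball.mem_nhds
        (mem_ball_iff_norm.mpr hxint)
      filter_upwards [hb, hU.mem_nhds hxU] with x' hx'b hx'U
      have h1 := hxmin (Metric.ball_subset_closedBall hx'b)
      simp only [Set.mem_ofPred_eq] at h1
      rw [hgU x hxU, hgU x' hx'U] at h1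
      linarith
    obtain ⟨hv, hup, hdist⟩ := cusp_contact hβ hA0 (hf2 x hxU) hloc hc
    have hxy : ‖x - y‖ ≤ 2 * Rm := by
      have h2 : ‖x - y‖ ≤ ‖x - x₀‖ + ‖x₀ - y‖ := by
        have := norm_add_le (x - x₀) (x₀ - y)
        simpa using this
      rw [norm_sub_rev x₀ y] at h2
      have h3 : ρ * (1 / (8 * K)) ≤ ρ * (1 / 8) := by gcongr
      linarith
    have hlow := laplacian_lower_bound_of_contact (p := ‖fderiv ℝ f x‖) (n := d) (v := f x) hD hγ
      hβ hK hM ht hc0 (norm_nonneg (fderiv ℝ f x)) (Nat.cast_nonneg d) hρM hcM (hdist.trans_le hxy)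
      (abs_sum_apply_single_le (fderiv ℝ f x)) (by rw [← hgU x hxU]; exact hgx)
      (hKM x hxU hxB) (hell x hxU)
    obtain ⟨hd1, hd2⟩ := vertexMap_fderiv_bound hβ hc0.le hC₀0 (hf2 x hxU) hup hlow
    exact ⟨x, ⟨⟨⟨hxint, hgx⟩, hd1⟩, hd2⟩, hv⟩
  have hvol : MeasureTheory.volume (Metric.ball x₀ (ρ * (1 / (8 * K)))) ≤
      ENNReal.ofReal (C₁ ^ d) * MeasureTheory.volume s := by
    calc MeasureTheory.volume (Metric.ball x₀ (ρ * (1 / (8 * K))))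
        ≤ MeasureTheory.volume (Ψ '' s') := MeasureTheory.measure_mono hcover
      _ ≤ ∫⁻ x in s', ENNReal.ofReal |(fderiv ℝ Ψ x).det| :=
          MeasureTheory.addHaar_image_le_lintegral_abs_det_fderiv _ hs'm
            fun x hx => (hx.1.2 : DifferentiableAt ℝ Ψ x).hasFDerivAt.hasFDerivWithinAt
      _ ≤ ∫⁻ _x in s', ENNReal.ofReal (C₁ ^ d) := by
          refine MeasureTheory.setLIntegral_mono' hs'm fun x hx => ?_
          refine ENNReal.ofReal_le_ofReal ((abs_det_le_opNorm_pow _).trans ?_)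
          exact pow_le_pow_left₀ (norm_nonneg _) hx.2 d
      _ = ENNReal.ofReal (C₁ ^ d) * MeasureTheory.volume s' :=
          MeasureTheory.setLIntegral_const _ _
      _ ≤ _ := by gcongr
  rw [MeasureTheory.Measure.addHaar_ball_of_pos _ _ (by positivity), finrank_euclideanSpace_fin,
    ← ENNReal.ofReal_toReal hωtop, ← hω, ← ENNReal.ofReal_mul (by positivity)] at hvol
  have hdiv : (1 / (8 * K)) ^ d * ω / C₁ ^ d * ρ ^ d =
      (C₁ ^ d)⁻¹ * ((ρ * (1 / (8 * K))) ^ d * ω) := by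
    rw [mul_pow]; field_simp
  rw [hdiv, ENNReal.ofReal_mul (by positivity), ENNReal.ofReal_inv_of_pos (by positivity)]
  calc _ ≤ (ENNReal.ofReal (C₁ ^ d))⁻¹ *
        (ENNReal.ofReal (C₁ ^ d) * MeasureTheory.volume s) := by gcongr
    _ = MeasureTheory.volume s := by
        rw [← mul_assoc, ENNReal.inv_mul_cancel (by simpa using pow_pos hC₁0 d)
          ENNReal.ofReal_ne_top, one_mul]

/-! ### From the integral bound to a pointwise bound -/

theorem mul_volume_superlevel_le_lintegral {d : ℕ} {U V : Set (Space d)} {f : Space d → ℝ}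
    {x₀ : Space d} {ρ h q : ℝ} (hU : IsOpen U) (hf : ContinuousOn f U) (hh : 0 ≤ h) (hq : 0 ≤ q)
    (hV : ∀ x ∈ U, ‖x - x₀‖ < ρ → x ∈ V) :
    ENNReal.ofReal (h ^ q) * MeasureTheory.volume {x | x ∈ U ∧ ‖x - x₀‖ < ρ ∧ h ≤ f x} ≤
      ∫⁻ x in V, ENNReal.ofReal (f x ^ q) := by
  set s : Set (Space d) := {x | x ∈ U ∧ ‖x - x₀‖ < ρ ∧ h ≤ f x} with hs
  have hsm : MeasurableSet s := by
    have h1 : IsOpen (U ∩ f ⁻¹' Set.Iio h) := hf.isOpen_inter_preimage hU isOpen_Iio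
    have h2 : s = (U \ (U ∩ f ⁻¹' Set.Iio h)) ∩ Metric.ball x₀ ρ := by
      ext x
      simp only [hs, Set.mem_ofPred_eq, Set.mem_inter_iff, Set.mem_sdiff, Set.mem_preimage,
        Set.mem_Iio, mem_ball_iff_norm, not_and, not_lt]
      tauto
    rw [h2]
    exact (hU.measurableSet.diff h1.measurableSet).inter Metric.isOpen_ball.measurableSet
  rw [← MeasureTheory.setLIntegral_const]
  refine le_trans (MeasureTheory.setLIntegral_mono' (g := fun x => ENNReal.ofReal (f x ^ q)) hsm
    fun x hx => ?_) (MeasureTheory.lintegral_mono_set fun x hx => hV x hx.1 hx.2.1)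
  exact ENNReal.ofReal_le_ofReal (Real.rpow_le_rpow hh hx.2.2 hq)

/-- The decay exponent of the pointwise bound as `t → 0`. -/
noncomputable def decayExp (d : ℕ) (θ γ β : ℝ) : ℝ :=
  (θ + 1) / (γ + β) / ((θ + 1) / (γ + β) + d / (β + 2))

/-- The exponent solves `ξ (e + f) = e` with `e = (θ+1)/(γ+β)` and `f = d/(β+2)`, so all powers of
`t` cancel. This makes the threshold in the pointwise bound uniform in time. -/
theorem mul_rpow_decayExp {d : ℕ} {θ γ β : ℝ} (hγ : 0 < γ) (hβ : 0 ≤ β) (hθ : 0 ≤ θ)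
    {ε t T : ℝ} (hε : 0 < ε) (ht : 0 < t) (hT : 0 < T) :
    (ε * (t / T) ^ decayExp d θ γ β / t) ^ ((θ + 1) / (γ + β)) *
        (ε * (t / T) ^ decayExp d θ γ β) ^ (d / (β + 2)) =
      ε ^ ((θ + 1) / (γ + β) + d / (β + 2)) * T ^ (-((θ + 1) / (γ + β))) := by
  have hm : 0 < γ + β := by linarith
  set e := (θ + 1) / (γ + β) with he
  set f := (d : ℝ) / (β + 2) with hf
  have he0 : 0 < e := by positivity
  have hf0 : 0 ≤ f := by positivity
  have hq : 0 < t / T := by positivity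
  have hqξ : 0 < (t / T) ^ decayExp d θ γ β := Real.rpow_pos_of_pos hq _
  have hZ : 0 < ε * (t / T) ^ decayExp d θ γ β := by positivity
  have hξ : decayExp d θ γ β * (e + f) = e := by
    rw [decayExp, ← he, ← hf, div_mul_cancel₀ _ (by positivity)]
  rw [Real.div_rpow hZ.le ht.le, div_mul_eq_mul_div, ← Real.rpow_add hZ,
    Real.mul_rpow hε.le hqξ.le, ← Real.rpow_mul hq.le, hξ, Real.div_rpow ht.le hT.le,
    Real.rpow_neg hT.le]
  have h1 : 0 < t ^ e := Real.rpow_pos_of_pos ht _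
  field_simp

/-- If the bound fails at `x₁`, a maximum point `x₀` of `u (|x| - 3r/2)^d` gives a ball on which `u
≤ 2^d u(x₀)`, as the measure estimate requires. That estimate then makes `∫ u^(θ+1)` exceed the
assumed bound. -/
theorem IsClassicalSolution.exists_pointwise_bound {d : ℕ} (hd : 1 ≤ d) {U : Set (Space d)}
    (hU : IsOpen U) (hUb : Bornology.IsBounded U) {a σ De γ β θ R₀ : ℝ} (ha : 0 < a)
    (hσ : 0 < σ ^ 2) (hγ : 0 < γ) (hβ : 0 ≤ β) (hθ : 0 ≤ θ) (hR₀ : 0 < R₀) {ε : ℝ} (hε : 0 < ε)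
    (hε1 : ε ≤ 1) :
    ∃ δ : ℝ, 0 < δ ∧ ∀ (r T : ℝ) (u₀ : Space d → ℝ) (u : Space d → ℝ → ℝ), 2 * R₀ < r → 0 < T →
      IsClassicalSolution U T a σ De γ β u₀ u →
      (∀ τ ∈ Set.Ioo 0 T, ∫⁻ x in extRegion U r 1, ENNReal.ofReal (u x τ ^ (θ + 1)) ≤
        ENNReal.ofReal (δ * T ^ (-((θ + 1) / (γ + β))))) →
      ∀ t ∈ Set.Ioo 0 T, ∀ x ∈ closure U, 8 / 5 * r ≤ ‖x‖ →
        u x t ^ (γ + β) * t ≤ ε * (t / T) ^ decayExp d θ γ β := by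
  have hm : 0 < γ + β := by linarith
  obtain ⟨Rm, hRm, hURm⟩ : ∃ Rm : ℝ, 0 < Rm ∧ ∀ x ∈ closure U, ‖x‖ ≤ Rm := by
    obtain ⟨R, hR, h⟩ := hUb.closure.exists_pos_norm_le
    exact ⟨R, hR, h⟩
  have hK : (1 : ℝ) ≤ 2 ^ d := one_le_pow₀ one_le_two
  obtain ⟨c, hc, hmeas⟩ := exists_volume_superlevel_ge d (D := σ ^ 2 / (2 * a)) (B := De / a)
    (K := 2 ^ d) (by positivity) hγ hβ hK hRm
  -- For `|x₁| ≥ 8r/5` the weight `|x₁| - 3r/2` is at least `r/10 > R₀/5`.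
  set η : ℝ := (R₀ / 5) ^ d with hη
  set c₁ : ℝ := η / Rm ^ d with hc₁
  have hη0 : 0 < η := by positivity
  have hc₁0 : 0 < c₁ := by positivity
  have hb2 : 0 < β + 2 := by linarith
  -- The first entry gives `ρ ≤ δ₀/2`, the second `ρ^(β+2) ≤ M^(γ+β) t`.
  set κ : ℝ := min (1 / 2) (c₁ ^ ((γ + β) / (β + 2)) / Rm) with hκ
  have hκ0 : 0 < κ := lt_min (by norm_num) (div_pos (Real.rpow_pos_of_pos hc₁0 _) hRm)
  have hκ1 : κ ≤ 1 / 2 := min_le_left _ _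
  have hκ2 : κ * Rm ≤ c₁ ^ ((γ + β) / (β + 2)) := by
    rw [← le_div_iff₀ hRm]; exact min_le_right _ _
  set e : ℝ := (θ + 1) / (γ + β) with he
  have he0 : 0 < e := by positivity
  set F : ℝ := e + d / (β + 2) with hF
  set δ₁ : ℝ := c * (1 / 2) ^ (θ + 1) * (c₁ ^ θ * η * κ ^ d) * ε ^ F with hδ₁
  have hδ₁0 : 0 < δ₁ := by positivity
  refine ⟨δ₁ / 2, by positivity, ?_⟩
  intro r T u₀ u hr hT h hint t ht x₁ hx₁ hx₁r
  have ht0 := ht.1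
  have htc : t ∈ Set.Icc 0 T := ⟨ht.1.le, ht.2.le⟩
  have htI : t ∈ Set.Ioc 0 T := ⟨ht.1, ht.2.le⟩
  by_contra! hcon
  have hq : 0 < t / T := by positivity
  have hq1 : t / T ≤ 1 := (div_le_one hT).mpr ht.2.le
  have hξ0 : 0 ≤ decayExp d θ γ β := by rw [decayExp]; positivity
  set Z : ℝ := ε * (t / T) ^ decayExp d θ γ β with hZ
  have hZ0 : 0 < Z := by positivity
  have hZ1 : Z ≤ 1 := mul_le_one₀ hε1 (by positivity) (Real.rpow_le_one hq.le hq1 hξ0)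
  set Y : ℝ := (Z / t) ^ (1 / (γ + β)) with hY
  have hY0 : 0 < Y := by positivity
  have hYm : Y ^ (γ + β) * t = Z := by
    rw [hY, ← Real.rpow_mul (by positivity), one_div_mul_cancel hm.ne', Real.rpow_one]
    field_simp
  have hu₁ : 0 ≤ u x₁ t := h.nonneg x₁ hx₁ t htc
  have hYu : Y < u x₁ t := by
    rw [← hYm] at hcon
    exact (Real.rpow_lt_rpow_iff hY0.le hu₁ hm).mp (lt_of_mul_lt_mul_right hcon ht0.le)
  -- the weighted maximum
  set W : Set (Space d) := {x | x ∈ closure U ∧ 3 / 2 * r ≤ ‖x‖} with hW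
  have hWc : IsCompact W := hUb.isCompact_closure.inter_right
    (isClosed_le continuous_const continuous_norm)
  have hwc : ContinuousOn (fun x => u x t * (‖x‖ - 3 / 2 * r) ^ d) W :=
    ((h.continuousOn_slice htc).mono fun x hx => hx.1).mul
      (by fun_prop : Continuous fun x : Space d => (‖x‖ - 3 / 2 * r) ^ d).continuousOn
  have hx₁W : x₁ ∈ W := ⟨hx₁, by linarith⟩
  obtain ⟨x₀, ⟨hx₀, hx₀r⟩, hmax⟩ := hWc.exists_isMaxOn ⟨x₁, hx₁W⟩ hwc
  set M := u x₀ t with hM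
  set δ₀ := ‖x₀‖ - 3 / 2 * r with hδ₀
  have hδ₀0 : 0 ≤ δ₀ := by rw [hδ₀]; linarith
  have hM0' : 0 ≤ M := h.nonneg x₀ hx₀ t htc
  have hMδ : Y * η ≤ M * δ₀ ^ d := by
    have h1 := hmax hx₁W
    simp only [Set.mem_ofPred_eq] at h1
    refine le_trans ?_ h1
    have h2 : R₀ / 5 ≤ ‖x₁‖ - 3 / 2 * r := by linarith
    rw [hη]
    gcongr
  have hMδpos : 0 < M * δ₀ ^ d := lt_of_lt_of_le (by positivity) hMδ
  have hM0 : 0 < M := by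
    rcases hM0'.eq_or_lt with h0 | h0
    · rw [← h0, zero_mul] at hMδpos; exact absurd hMδpos (lt_irrefl _)
    · exact h0
  have hδ₀pos : 0 < δ₀ := by
    rcases hδ₀0.eq_or_lt with h0 | h0
    · rw [← h0, zero_pow (by omega), mul_zero] at hMδpos; exact absurd hMδpos (lt_irrefl _)
    · exact h0
  have hδ₀R : δ₀ ≤ Rm := by
    have := hURm x₀ hx₀
    rw [hδ₀]; linarith
  have hMY : c₁ * Y ≤ M := by
    rw [hc₁, div_mul_eq_mul_div, div_le_iff₀ (by positivity)]
    calc η * Y = Y * η := mul_comm _ _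
      _ ≤ M * δ₀ ^ d := hMδ
      _ ≤ M * Rm ^ d := by gcongr
  have hx₀U : x₀ ∈ U := by
    by_contra hx
    have hf : x₀ ∈ frontier U := ⟨hx₀, by rwa [hU.interior_eq]⟩
    exact hM0.ne' (h.eq_zero_of_mem_frontier hT hf htc)
  set ρ : ℝ := κ * δ₀ * Z ^ (1 / (β + 2)) with hρ
  have hρ0 : 0 < ρ := by positivity
  have hZβ : Z ^ (1 / (β + 2)) ≤ 1 := Real.rpow_le_one hZ0.le hZ1 (by positivity)
  have hρδ : ρ ≤ δ₀ / 2 := by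
    calc ρ ≤ 1 / 2 * δ₀ * 1 := by rw [hρ]; gcongr
      _ = δ₀ / 2 := by ring
  have hρM : ρ ^ (β + 2) ≤ M ^ (γ + β) * t := by
    have h1 : κ * δ₀ ≤ c₁ ^ ((γ + β) / (β + 2)) :=
      (mul_le_mul_of_nonneg_left hδ₀R hκ0.le).trans hκ2
    calc ρ ^ (β + 2) = (κ * δ₀) ^ (β + 2) * Z := by
          rw [hρ, Real.mul_rpow (by positivity) (by positivity), ← Real.rpow_mul hZ0.le,
            one_div_mul_cancel hb2.ne', Real.rpow_one]
      _ ≤ (c₁ ^ ((γ + β) / (β + 2))) ^ (β + 2) * Z := by gcongr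
      _ = c₁ ^ (γ + β) * Z := by
          rw [← Real.rpow_mul hc₁0.le, div_mul_cancel₀ _ hb2.ne']
      _ = (c₁ * Y) ^ (γ + β) * t := by
          rw [Real.mul_rpow hc₁0.le hY0.le, mul_assoc, hYm]
      _ ≤ M ^ (γ + β) * t := by gcongr
  have hfar : ∀ x, ‖x - x₀‖ ≤ ρ → δ₀ / 2 ≤ ‖x‖ - 3 / 2 * r := by
    intro x hx
    have h1 : ‖x₀‖ ≤ ‖x‖ + ‖x - x₀‖ := by
      have h2 := norm_sub_norm_le x₀ x
      rw [norm_sub_rev] at h2; linarith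
    have h3 : δ₀ / 2 = δ₀ - δ₀ / 2 := by ring
    rw [h3]
    nth_rewrite 1 [hδ₀]
    linarith
  have hKM : ∀ x ∈ U, ‖x - x₀‖ ≤ ρ → u x t ≤ 2 ^ d * M := by
    intro x hx hxρ
    have h1 := hfar x hxρ
    have h2 := hmax (a := x) ⟨subset_closure hx, by linarith⟩
    simp only [Set.mem_ofPred_eq] at h2
    have h3 : 0 ≤ u x t := h.nonneg x (subset_closure hx) t htc
    have h4 : u x t * (δ₀ / 2) ^ d ≤ M * δ₀ ^ d := by
      refine le_trans ?_ h2
      gcongr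
    rw [div_pow, mul_div_assoc', div_le_iff₀ (by positivity)] at h4
    have h5 : 0 < δ₀ ^ d := by positivity
    refine le_of_mul_le_mul_right ?_ h5
    linarith
  have hvol := hmeas U (fun x => u x t) x₀ ρ M t hU (h.continuousOn_slice htc)
    (fun x hx => h.eq_zero_of_mem_frontier hT hx htc) (fun x hx => h.contDiffAt hU hx htI)
    (fun x hx => h.elliptic_inequality hU hUb ha hγ hβ hx htI) hρ0 (by linarith) hM0 ht0 hx₀U rfl
    hKM hρM
  have hlow := mul_volume_superlevel_le_lintegral (V := extRegion U r 1) (x₀ := x₀) (ρ := ρ)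
    (h := M / 2) (q := θ + 1) hU ((h.continuousOn_slice htc).mono subset_closure) (by positivity)
    (by positivity) (fun x hx hxρ => ⟨hx, by
      have h1 := hfar x hxρ.le
      rw [mem_ball_zero_iff, not_lt, radius]
      norm_num
      linarith⟩)
  have hfin : ENNReal.ofReal ((M / 2) ^ (θ + 1) * (c * ρ ^ d)) ≤
      ENNReal.ofReal (δ₁ / 2 * T ^ (-e)) := by
    rw [ENNReal.ofReal_mul (by positivity)]
    exact (mul_le_mul_right hvol _).trans (hlow.trans (hint t ht))
  have hTe : 0 < T ^ (-e) := Real.rpow_pos_of_pos hT _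
  rw [ENNReal.ofReal_le_ofReal_iff (by positivity)] at hfin
  -- The weight carries the power `d` for this step: `M^(θ+1) δ₀^d = M^θ (M δ₀^d)` is bounded below
  -- by a multiple of `Y^(θ+1)`, however small `δ₀` is.
  have hkey : δ₁ * T ^ (-e) ≤ (M / 2) ^ (θ + 1) * (c * ρ ^ d) := by
    have h1 : ρ ^ d = κ ^ d * δ₀ ^ d * Z ^ ((d : ℝ) / (β + 2)) := by
      rw [hρ, mul_pow, mul_pow, ← Real.rpow_mul_natCast hZ0.le]
      congr 2
      ring
    have h2 : M ^ (θ + 1) = M ^ θ * M := Real.rpow_add_one hM0.ne' θ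
    have h3 : (c₁ * Y) ^ θ ≤ M ^ θ := by gcongr
    have h4 : Y ^ θ * Y = (Z / t) ^ e := by
      rw [← Real.rpow_add_one hY0.ne', hY, ← Real.rpow_mul (by positivity)]
      congr 1
      rw [he]; ring
    have h5 := mul_rpow_decayExp (d := d) (θ := θ) hγ hβ hθ hε ht0 hT
    rw [← hZ, ← he, ← hF] at h5
    have h6 : (M / 2) ^ (θ + 1) = (1 / 2) ^ (θ + 1) * M ^ (θ + 1) := by
      rw [← Real.mul_rpow (by norm_num) hM0.le]; congr 1; ring
    calc δ₁ * T ^ (-e) = c * (1 / 2) ^ (θ + 1) * (c₁ ^ θ * η * κ ^ d) * (ε ^ F * T ^ (-e)) := by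
          rw [hδ₁]; ring
      _ = c * (1 / 2) ^ (θ + 1) * (κ ^ d * Z ^ ((d : ℝ) / (β + 2))) *
            ((c₁ * Y) ^ θ * (Y * η)) := by
          rw [← h5, ← h4, Real.mul_rpow hc₁0.le hY0.le]; ring
      _ ≤ c * (1 / 2) ^ (θ + 1) * (κ ^ d * Z ^ ((d : ℝ) / (β + 2))) *
            (M ^ θ * (M * δ₀ ^ d)) := by gcongr
      _ = (M / 2) ^ (θ + 1) * (c * ρ ^ d) := by rw [h1, h6, h2]; ring
  have : 0 < δ₁ * T ^ (-e) := by positivity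
  linarith

/-! ### Travelling fronts and finite speed of propagation -/

/-- A positive smooth approximation of the travelling front `(A s₊) ^ n`. -/
noncomputable def frontProfile (A ε n s : ℝ) : ℝ := (A * ((s + √(s ^ 2 + ε ^ 2)) / 2)) ^ n

section frontProfile

variable {A ε n : ℝ}

theorem lt_half_add_sqrt (hε : 0 < ε) (s : ℝ) : max s 0 < (s + √(s ^ 2 + ε ^ 2)) / 2 := by
  have h1 : |s| < √(s ^ 2 + ε ^ 2) := by
    rw [← Real.sqrt_sq_eq_abs]
    exact Real.sqrt_lt_sqrt (sq_nonneg s) (by nlinarith [pow_pos hε 2])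
  rw [max_lt_iff]
  constructor <;> linarith [le_abs_self s, neg_abs_le s]

theorem half_add_sqrt_le (hε : 0 < ε) (s : ℝ) :
    (s + √(s ^ 2 + ε ^ 2)) / 2 ≤ max s 0 + ε / 2 := by
  have h1 : √(s ^ 2 + ε ^ 2) ≤ |s| + ε := by
    rw [Real.sqrt_le_left (by positivity)]
    nlinarith [sq_abs s, abs_nonneg s]
  rcases le_total 0 s with h | h
  · rw [max_eq_left h]; rw [abs_of_nonneg h] at h1; linarith
  · rw [max_eq_right h]; rw [abs_of_nonpos h] at h1; linarith

theorem frontProfile_pos (hA : 0 < A) (hε : 0 < ε) (s : ℝ) : 0 < frontProfile A ε n s := by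
  have := (le_max_right s 0).trans_lt (lt_half_add_sqrt hε s)
  exact Real.rpow_pos_of_pos (mul_pos hA this) _

theorem hasDerivAt_sqrt_sq_add_sq (hε : 0 < ε) (s : ℝ) :
    HasDerivAt (fun s : ℝ => √(s ^ 2 + ε ^ 2)) (s / √(s ^ 2 + ε ^ 2)) s := by
  have hpos : 0 < s ^ 2 + ε ^ 2 := by positivity
  have h1 : HasDerivAt (fun s : ℝ => s ^ 2 + ε ^ 2) (2 * s) s := by
    simpa using ((hasDerivAt_id s).pow 2).add_const (ε ^ 2)
  refine (h1.sqrt hpos.ne').congr_deriv ?_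
  have : √(s ^ 2 + ε ^ 2) ≠ 0 := (Real.sqrt_pos.mpr hpos).ne'
  field_simp

theorem hasDerivAt_frontProfile (hA : 0 < A) (hε : 0 < ε) (s : ℝ) :
    HasDerivAt (frontProfile A ε n) (n * frontProfile A ε n s / √(s ^ 2 + ε ^ 2)) s := by
  have hq : 0 < √(s ^ 2 + ε ^ 2) := Real.sqrt_pos.mpr (by positivity)
  have hh := (le_max_right s 0).trans_lt (lt_half_add_sqrt hε s)
  have h1 := (((hasDerivAt_id s).add (hasDerivAt_sqrt_sq_add_sq hε s)).div_const 2).const_mul A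
  have h2 := h1.rpow_const (p := n) (Or.inl (mul_pos hA hh).ne')
  refine h2.congr_deriv ?_
  simp only [Pi.add_apply, id]
  rw [frontProfile]
  set q := √(s ^ 2 + ε ^ 2) with hqd
  have h3 : (A * ((s + q) / 2)) ^ n = (A * ((s + q) / 2)) ^ (n - 1) * (A * ((s + q) / 2)) := by
    rw [← Real.rpow_add_one (mul_pos hA hh).ne']; ring_nf
  rw [h3]
  field_simp
  ring

theorem hasDerivAt_deriv_frontProfile (hA : 0 < A) (hε : 0 < ε) (s : ℝ) :
    HasDerivAt (fun s => n * frontProfile A ε n s / √(s ^ 2 + ε ^ 2))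
      (n * frontProfile A ε n s / (s ^ 2 + ε ^ 2) * (n - s / √(s ^ 2 + ε ^ 2))) s := by
  have hpos : 0 < s ^ 2 + ε ^ 2 := by positivity
  have hq : 0 < √(s ^ 2 + ε ^ 2) := Real.sqrt_pos.mpr hpos
  have h1 := ((hasDerivAt_frontProfile (n := n) hA hε s).const_mul n).div
    (hasDerivAt_sqrt_sq_add_sq hε s) hq.ne'
  refine h1.congr_deriv ?_
  have hs : √(s ^ 2 + ε ^ 2) ^ 2 = s ^ 2 + ε ^ 2 := Real.sq_sqrt hpos.le
  rw [← hs, Real.sqrt_sq hq.le]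
  field_simp

theorem contDiff_frontProfile (hA : 0 < A) (hε : 0 < ε) : ContDiff ℝ 2 (frontProfile A ε n) := by
  have h1 : ContDiff ℝ 2 fun s : ℝ => √(s ^ 2 + ε ^ 2) :=
    ((contDiff_id.pow 2).add contDiff_const).sqrt fun s => by positivity
  refine ContDiff.rpow_const_of_ne (contDiff_const.mul ((contDiff_id.add h1).div_const 2))
    fun s => ?_
  have := (le_max_right s 0).trans_lt (lt_half_add_sqrt hε s)
  exact (mul_pos hA this).ne'

/-- The front profile is a strict supersolution in a travelling frame. -/
theorem frontProfile_supersolution {γ β D b c s : ℝ} (hγ : 0 < γ) (hβ : 0 ≤ β) (hD : 0 ≤ D)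
    (hb : 0 ≤ b) (hA : 0 < A) (hε : 0 < ε) (hε1 : ε ≤ 1) (hn : n = (β + 1) / (γ + β))
    (hc : n ^ β * (D * (n + 1) + 3 * b) * A ^ (β + 1) < c) (hs : s ≤ 2) :
    frontProfile A ε n s ^ γ * (n * frontProfile A ε n s / √(s ^ 2 + ε ^ 2)) ^ β *
      (D * (n * frontProfile A ε n s / (s ^ 2 + ε ^ 2) * (n - s / √(s ^ 2 + ε ^ 2)))
        + b * (n * frontProfile A ε n s / √(s ^ 2 + ε ^ 2))) <
      c * (n * frontProfile A ε n s / √(s ^ 2 + ε ^ 2)) := by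
  have hm : 0 < γ + β := by linarith
  have hn0 : 0 < n := by rw [hn]; positivity
  have hpos : 0 < s ^ 2 + ε ^ 2 := by positivity
  have hq : 0 < √(s ^ 2 + ε ^ 2) := Real.sqrt_pos.mpr hpos
  have hqs : √(s ^ 2 + ε ^ 2) ^ 2 = s ^ 2 + ε ^ 2 := Real.sq_sqrt hpos.le
  have hh := (le_max_right s 0).trans_lt (lt_half_add_sqrt hε s)
  have hh3 : (s + √(s ^ 2 + ε ^ 2)) / 2 ≤ 3 := by
    have h1 := half_add_sqrt_le hε s
    have h2 : max s 0 ≤ 2 := max_le hs (by norm_num)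
    linarith
  have hsq : |s| ≤ √(s ^ 2 + ε ^ 2) := by
    rw [← Real.sqrt_sq_eq_abs]
    exact Real.sqrt_le_sqrt (by nlinarith)
  have hg0 : 0 < frontProfile A ε n s := frontProfile_pos hA hε s
  -- With `n(γ+β) = β+1` the degenerate coefficient produces `h^(β+1)`. As `h ≤ q`, this absorbs the
  -- factor `q^(-β-1)`, and the bound is uniform in `ε`.
  have hgm : frontProfile A ε n s ^ (γ + β) =
      A ^ (β + 1) * ((s + √(s ^ 2 + ε ^ 2)) / 2) ^ (β + 1) := by
    rw [frontProfile, ← Real.rpow_mul (by positivity), ← Real.mul_rpow hA.le hh.le, hn,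
      div_mul_cancel₀ _ hm.ne']
  rw [← hqs, Real.sqrt_sq hq.le]
  set q := √(s ^ 2 + ε ^ 2) with hqd
  set h := (s + q) / 2 with hhd
  set g := frontProfile A ε n s with hgd
  have hhq : h ≤ q := by rw [hhd]; linarith [le_abs_self s]
  have hneg : -(s / q) ≤ 1 := by
    rw [neg_le_iff_add_nonneg, ← sub_nonneg]
    have : -1 ≤ s / q := by
      rw [le_div_iff₀ hq]; linarith [neg_abs_le s]
    linarith
  have h1 : D * (n * g / q ^ 2 * (n - s / q)) + b * (n * g / q) ≤
      n * g / q * (D * (n + 1) / q + b) := by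
    have h2 : D * (n * g / q ^ 2 * (n - s / q)) ≤ D * (n * g / q ^ 2 * (n + 1)) := by
      gcongr; linarith
    calc _ ≤ D * (n * g / q ^ 2 * (n + 1)) + b * (n * g / q) := by linarith
      _ = _ := by field_simp
  have hqβ : 0 < q ^ β := Real.rpow_pos_of_pos hq _
  have h3 : g ^ γ * (n * g / q) ^ β = n ^ β * A ^ (β + 1) * (h ^ (β + 1) / q ^ β) := by
    rw [Real.div_rpow (by positivity) hq.le, Real.mul_rpow hn0.le hg0.le]
    have : g ^ γ * g ^ β = A ^ (β + 1) * h ^ (β + 1) := by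
      rw [← Real.rpow_add hg0]; exact hgm
    calc g ^ γ * (n ^ β * g ^ β / q ^ β) = n ^ β * (g ^ γ * g ^ β) / q ^ β := by ring
      _ = _ := by rw [this]; ring
  have h4 : h ^ (β + 1) / q ^ β ≤ h := by
    rw [div_le_iff₀ hqβ, Real.rpow_add_one hh.ne', mul_comm]
    gcongr
  have h5 : h ^ (β + 1) / q ^ β * (D * (n + 1) / q + b) ≤ D * (n + 1) + 3 * b := by
    calc h ^ (β + 1) / q ^ β * (D * (n + 1) / q + b) ≤ h * (D * (n + 1) / q + b) := by gcongr
      _ = D * (n + 1) * (h / q) + h * b := by ring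
      _ ≤ D * (n + 1) * 1 + 3 * b := by
          gcongr
          exact (div_le_one hq).mpr hhq
      _ = _ := by ring
  have hgq : 0 < n * g / q := by positivity
  calc g ^ γ * (n * g / q) ^ β * (D * (n * g / q ^ 2 * (n - s / q)) + b * (n * g / q))
      ≤ g ^ γ * (n * g / q) ^ β * (n * g / q * (D * (n + 1) / q + b)) := by gcongr
    _ = n * g / q * (n ^ β * A ^ (β + 1) * (h ^ (β + 1) / q ^ β * (D * (n + 1) / q + b))) := by
        rw [h3]; ring
    _ ≤ n * g / q * (n ^ β * A ^ (β + 1) * (D * (n + 1) + 3 * b)) := by gcongr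
    _ = n * g / q * (n ^ β * (D * (n + 1) + 3 * b) * A ^ (β + 1)) := by ring
    _ < n * g / q * c := by gcongr
    _ = c * (n * g / q) := by ring

end frontProfile

/-- Derivatives of a planar function. -/
theorem planar_derivatives {d : ℕ} {g g₁ g₂ : ℝ → ℝ} (hg : ∀ s, HasDerivAt g (g₁ s) s)
    (hg₁ : ∀ s, HasDerivAt g₁ (g₂ s) s) (e : Space d) (b : ℝ) (x : Space d) :
    fderiv ℝ (fun y => g (b - inner ℝ e y)) x = (-g₁ (b - inner ℝ e x)) • innerSL ℝ e ∧
      Laplacian.laplacian (fun y => g (b - inner ℝ e y)) x =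
        g₂ (b - inner ℝ e x) * ‖e‖ ^ 2 := by
  have hin : ∀ y : Space d, HasFDerivAt (fun y : Space d => b - inner ℝ e y) (-innerSL ℝ e) y :=
    fun y => ((innerSL ℝ e).hasFDerivAt (x := y)).const_sub b
  have h1 : ∀ y : Space d, fderiv ℝ (fun y => g (b - inner ℝ e y)) y =
      (-g₁ (b - inner ℝ e y)) • innerSL ℝ e := by
    intro y
    have := (hg (b - inner ℝ e y)).comp_hasFDerivAt y (hin y)
    refine this.fderiv.trans ?_
    rw [smul_neg, neg_smul]
  refine ⟨h1 x, ?_⟩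
  have h2 : fderiv ℝ (fun y : Space d => g (b - inner ℝ e y)) =
      fun y => (-g₁ (b - inner ℝ e y)) • innerSL ℝ e := funext h1
  have h3 : HasFDerivAt (fun y : Space d => -g₁ (b - inner ℝ e y))
      (-(g₂ (b - inner ℝ e x) • -innerSL ℝ e)) x :=
    ((hg₁ (b - inner ℝ e x)).comp_hasFDerivAt x (hin x)).neg
  rw [laplacian_eq_sum_fderiv_fderiv, h2, (h3.smul_const (innerSL ℝ e)).fderiv,
    EuclideanSpace.norm_sq_eq, Finset.mul_sum]
  refine Finset.sum_congr rfl fun i _ => ?_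
  have h4 : inner ℝ e (EuclideanSpace.single i (1 : ℝ)) = e i := by
    rw [EuclideanSpace.inner_single_right]; simp
  simp only [ContinuousLinearMap.smulRight_apply, smul_apply, neg_apply, innerSL_apply_apply, h4,
    smul_eq_mul, Real.norm_eq_abs, sq_abs]
  ring

namespace IsClassicalSolution

variable {d : ℕ} {U : Set (Space d)} {T a σ De γ β : ℝ} {u₀ : Space d → ℝ}
  {u : Space d → ℝ → ℝ}

/-- Comparison with a planar travelling front in the half space `ρ ≤ ⟪e, x⟫`. -/
theorem le_frontProfile (h : IsClassicalSolution U T a σ De γ β u₀ u) (hU : IsOpen U)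
    (hUb : Bornology.IsBounded U) (hT : 0 < T) (ha : 0 < a) (hγ : 0 < γ) (hβ : 0 ≤ β)
    {n A ε c ρ ℓ M t₁ t₂ : ℝ} {e : Space d} (he : ‖e‖ = 1) (hn : n = (β + 1) / (γ + β))
    (hA : 0 < A) (hε : 0 < ε) (hε1 : ε ≤ 1) (hℓ : 0 < ℓ) (hℓ1 : ℓ ≤ 1)
    (hc : n ^ β * (σ ^ 2 / (2 * a) * (n + 1) + 3 * (|De / a| * d)) * A ^ (β + 1) < c)
    (ht₁ : 0 ≤ t₁) (ht₂ : t₂ ≤ T) (hct : c * (t₂ - t₁) ≤ ℓ) (hM : M ≤ (A * ℓ) ^ n)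
    (hinit : ∀ x ∈ closure U, ρ ≤ inner ℝ e x → u x t₁ = 0)
    (hlat : ∀ x ∈ closure U, ρ ≤ inner ℝ e x → ∀ t ∈ Set.Icc t₁ t₂, u x t ≤ M)
    {x : Space d} (hx : x ∈ closure U) (hxρ : ρ ≤ inner ℝ e x) {t : ℝ}
    (ht : t ∈ Set.Icc t₁ t₂) :
    u x t ≤ frontProfile A ε n (ρ + ℓ + c * (t - t₁) - inner ℝ e x) := by
  have hm : 0 < γ + β := by linarith
  have hn0 : 0 < n := by rw [hn]; positivity
  have hc0 : 0 < c := lt_of_le_of_lt (by positivity) hc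
  set V : Space d → ℝ → ℝ := fun x t =>
    frontProfile A ε n (ρ + ℓ + c * (t - t₁) - inner ℝ e x) with hV
  have hVpos : ∀ x t, 0 < V x t := fun x t => frontProfile_pos hA hε _
  have hVc : Continuous fun z : Space d × ℝ => V z.1 z.2 :=
    (contDiff_frontProfile hA hε).continuous.comp (by fun_prop)
  by_contra! hcon
  set Q : Set (Space d × ℝ) := (closure U ∩ {x | ρ ≤ inner ℝ e x}) ×ˢ Set.Icc t₁ t₂ with hQ
  have hQc : IsCompact Q := by
    refine IsCompact.prod (hUb.isCompact_closure.inter_right ?_) isCompact_Icc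
    exact isClosed_le continuous_const (by fun_prop)
  have huQ : ContinuousOn (fun z : Space d × ℝ => u z.1 z.2) Q :=
    h.regular.continuousOn_closure.mono fun z hz =>
      ⟨hz.1.1, ht₁.trans hz.2.1, hz.2.2.trans ht₂⟩
  -- A point of this compact set with least time is a first contact of the solution with the front.
  set B : Set (Space d × ℝ) := Q ∩ {z | V z.1 z.2 ≤ u z.1 z.2} with hB
  have hBc : IsCompact B := by
    have : IsClosed B := by
      have h1 : ContinuousOn (fun z : Space d × ℝ => u z.1 z.2 - V z.1 z.2) Q :=
        huQ.sub hVc.continuousOn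
      have h2 := h1.preimage_isClosed_of_isClosed hQc.isClosed isClosed_Ici (t := Set.Ici (0 : ℝ))
      convert! h2 using 1
      ext z
      simp [hB]
    exact hQc.of_isClosed_subset this Set.inter_subset_left
  obtain ⟨⟨x₀, t₀⟩, hz₀, hmin⟩ := hBc.exists_isMinOn ⟨(x, t), ⟨⟨⟨hx, hxρ⟩, ht⟩, hcon.le⟩⟩
    continuous_snd.continuousOn
  obtain ⟨⟨⟨hx₀, hx₀ρ⟩, ht₀⟩, hVu⟩ := hz₀
  simp only [Set.mem_ofPred_eq] at hx₀ρ hVu hx₀ ht₀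
  have hbefore : ∀ y ∈ closure U, ρ ≤ inner ℝ e y → ∀ s ∈ Set.Ico t₁ t₀, u y s < V y s := by
    intro y hy hyρ s hs
    by_contra! hcon'
    have := hmin (a := (y, s)) ⟨⟨⟨hy, hyρ⟩, hs.1, hs.2.le.trans ht₀.2⟩, hcon'⟩
    simp only [Set.mem_ofPred_eq] at this
    linarith [hs.2]
  have ht₀pos : t₁ < t₀ := by
    refine lt_of_le_of_ne ht₀.1 fun heq => ?_
    have h1 := hinit x₀ hx₀ hx₀ρ
    rw [heq] at h1
    rw [h1] at hVu
    linarith [hVpos x₀ t₀]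
  have ht₀I : t₀ ∈ Set.Ioc 0 T := ⟨by linarith, ht₀.2.trans ht₂⟩
  have hx₀U : x₀ ∈ U := by
    by_contra hx
    have hf : x₀ ∈ frontier U := ⟨hx₀, by rwa [hU.interior_eq]⟩
    have h1 := h.eq_zero_of_mem_frontier hT hf ⟨ht₀I.1.le, ht₀I.2⟩
    rw [h1] at hVu
    linarith [hVpos x₀ t₀]
  -- On the face `⟪e, x⟫ = ρ` the front argument is at least `ℓ`, so the front exceeds `(Aℓ)^n ≥ M ≥
  -- u`.
  have hx₀lt : ρ < inner ℝ e x₀ := by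
    refine lt_of_le_of_ne hx₀ρ fun heq => ?_
    have h1 := hlat x₀ hx₀ hx₀ρ t₀ ht₀
    have h2 : (A * ℓ) ^ n < V x₀ t₀ := by
      refine Real.rpow_lt_rpow (by positivity) ?_ hn0
      refine mul_lt_mul_of_pos_left (lt_of_le_of_lt ?_ (lt_half_add_sqrt hε _)) hA
      refine le_trans ?_ (le_max_left _ _)
      rw [← heq]
      have : 0 ≤ c * (t₀ - t₁) := mul_nonneg hc0.le (by linarith)
      linarith
    linarith
  have huxt : ∀ y ∈ U, ρ ≤ inner ℝ e y → u y t₀ ≤ V y t₀ := by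
    intro y hy hyρ
    have hyc : ContinuousWithinAt (fun s => u y s) (Set.Icc 0 T) t₀ :=
      (h.regular.continuousOn_closure.comp (f := fun s : ℝ => (y, s)) (by fun_prop)
        (fun s hs => ⟨subset_closure hy, hs⟩)) t₀ ⟨ht₀I.1.le, ht₀I.2⟩
    have h1 : Filter.Tendsto (fun s => u y s) (nhdsWithin t₀ (Set.Ioo t₁ t₀)) (nhds (u y t₀)) :=
      hyc.mono_left (nhdsWithin_mono _ fun s hs => ⟨by linarith [hs.1], by linarith [hs.2, ht₀I.2]⟩)
    have h2 : Filter.Tendsto (fun s => V y s) (nhdsWithin t₀ (Set.Ioo t₁ t₀)) (nhds (V y t₀)) :=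
      ((hVc.comp (by fun_prop : Continuous fun s : ℝ => (y, s))).tendsto t₀).mono_left
        nhdsWithin_le_nhds
    have hne : (nhdsWithin t₀ (Set.Ioo t₁ t₀)).NeBot := by
      rw [nhdsWithin_Ioo_eq_nhdsLT ht₀pos]; infer_instance
    refine le_of_tendsto_of_tendsto h1 h2 ?_
    filter_upwards [self_mem_nhdsWithin] with s hs
    exact (hbefore y (subset_closure hy) hyρ s ⟨hs.1.le, hs.2⟩).le
  have heq : u x₀ t₀ = V x₀ t₀ := le_antisymm (huxt x₀ hx₀U hx₀ρ) hVu
  set s₀ : ℝ := ρ + ℓ + c * (t₀ - t₁) - inner ℝ e x₀ with hs₀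
  have hs₀2 : s₀ ≤ 2 := by
    have : c * (t₀ - t₁) ≤ c * (t₂ - t₁) := by gcongr; exact ht₀.2
    linarith
  have hloc : IsLocalMax (fun y => u y t₀ - V y t₀) x₀ := by
    have hopen : {y : Space d | ρ < inner ℝ e y} ∈ nhds x₀ :=
      (isOpen_lt continuous_const (by fun_prop)).mem_nhds hx₀lt
    filter_upwards [hU.mem_nhds hx₀U, hopen] with y hy hyρ
    have h1 := huxt y hy (le_of_lt hyρ)
    rw [heq, sub_self]
    linarith
  have hVcd : ContDiffAt ℝ 2 (fun y => V y t₀) x₀ :=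
    ((contDiff_frontProfile hA hε).comp
      (contDiff_const.sub (contDiff_const.inner ℝ contDiff_id))).contDiffAt
  obtain ⟨hfd, hlap, -⟩ := contact_conditions hloc (h.contDiffAt hU hx₀U ht₀I) hVcd
  obtain ⟨hV1, hV2⟩ := planar_derivatives (fun s => hasDerivAt_frontProfile (n := n) hA hε s)
    (fun s => hasDerivAt_deriv_frontProfile (n := n) hA hε s) e (ρ + ℓ + c * (t₀ - t₁)) x₀
  rw [he, one_pow, mul_one] at hV2
  rw [hV1] at hfd
  rw [hV2] at hlap
  set g := frontProfile A ε n s₀ with hg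
  set g₁ := n * frontProfile A ε n s₀ / √(s₀ ^ 2 + ε ^ 2) with hg₁
  have hg₁0 : 0 ≤ g₁ := by
    have := frontProfile_pos (n := n) hA hε s₀
    positivity
  have hnorm : ‖fderiv ℝ (fun y => u y t₀) x₀‖ = g₁ := by
    rw [hfd, norm_smul, innerSL_apply_norm, he, mul_one, norm_neg, Real.norm_of_nonneg hg₁0]
  have hdt := h.hasDerivWithinAt hx₀U ht₀I
  have hVt : HasDerivAt (fun s => V x₀ s) (g₁ * c) t₀ := by
    have h1 : HasDerivAt (fun s => ρ + ℓ + c * (s - t₁) - inner ℝ e x₀) c t₀ := by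
      have := ((((hasDerivAt_id t₀).sub_const t₁).const_mul c).const_add (ρ + ℓ)).sub_const
        (inner ℝ e x₀ : ℝ)
      simpa using this
    exact (hasDerivAt_frontProfile (n := n) hA hε s₀).comp t₀ h1
  have hdiff := (hdt.sub hVt.hasDerivWithinAt).nonneg_of_eventually_le (by
    filter_upwards [Ioo_mem_nhdsLT ht₀pos] with s hs
    have h1 := hbefore x₀ hx₀ hx₀ρ s ⟨hs.1.le, hs.2⟩
    simp only [Pi.sub_apply]
    rw [heq]
    linarith)
  rw [hnorm, heq] at hdiff
  have hS : -(De / a * ∑ i : Fin d, fderiv ℝ (fun y => u y t₀) x₀ (EuclideanSpace.single i 1)) ≤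
      |De / a| * d * g₁ := by
    have h1 := abs_sum_apply_single_le (fderiv ℝ (fun y => u y t₀) x₀)
    rw [hnorm] at h1
    refine (neg_le_abs _).trans ?_
    rw [abs_mul, mul_assoc]
    gcongr
  have hstrict := frontProfile_supersolution (s := s₀) (c := c) hγ hβ
    (by positivity : 0 ≤ σ ^ 2 / (2 * a)) (by positivity : 0 ≤ |De / a| * (d : ℝ)) hA hε hε1 hn hc hs₀2
  rw [← hg₁, ← hg] at hstrict
  have hVg : V x₀ t₀ = g := rfl
  rw [hVg] at hdiff
  have hg0 : 0 ≤ g := (frontProfile_pos hA hε s₀).le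
  have hD : 0 ≤ σ ^ 2 / (2 * a) := by positivity
  have hlast : g ^ γ * g₁ ^ β *
      (σ ^ 2 / (2 * a) * Laplacian.laplacian (fun y => u y t₀) x₀
        - De / a * ∑ i : Fin d, fderiv ℝ (fun y => u y t₀) x₀ (EuclideanSpace.single i 1)) ≤
      g ^ γ * g₁ ^ β * (σ ^ 2 / (2 * a) * (n * g / (s₀ ^ 2 + ε ^ 2) *
        (n - s₀ / √(s₀ ^ 2 + ε ^ 2))) + |De / a| * d * g₁) := by
    refine mul_le_mul_of_nonneg_left ?_ (by positivity)
    have := mul_le_mul_of_nonneg_left hlap hD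
    linarith
  linarith

/-- Quantitative finite speed of propagation on a time interval. -/
theorem eq_zero_of_front_step (h : IsClassicalSolution U T a σ De γ β u₀ u) (hU : IsOpen U)
    (hUb : Bornology.IsBounded U) (hT : 0 < T) (ha : 0 < a) (hγ : 0 < γ) (hβ : 0 ≤ β)
    {n C ρ ℓ M t₁ t₂ : ℝ} (hn : n = (β + 1) / (γ + β))
    (hC : n ^ β * (σ ^ 2 / (2 * a) * (n + 1) + 3 * (|De / a| * d)) < C) (hρ : 0 < ρ)
    (hℓ : 0 < ℓ) (hℓ1 : ℓ ≤ 1) (hM : 0 < M) (ht₁ : 0 ≤ t₁) (ht₂ : t₂ ≤ T)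
    (hCM : C * M ^ (γ + β) * (t₂ - t₁) ≤ ℓ ^ (β + 2))
    (hinit : ∀ x ∈ closure U, ρ ≤ ‖x‖ → u x t₁ = 0)
    (hlat : ∀ x ∈ closure U, ρ ≤ ‖x‖ → ∀ t ∈ Set.Icc t₁ t₂, u x t ≤ M)
    {x : Space d} (hx : x ∈ closure U) (hxρ : ρ + 2 * ℓ ≤ ‖x‖) {t : ℝ} (ht : t ∈ Set.Icc t₁ t₂) :
    u x t = 0 := by
  have hm : 0 < γ + β := by linarith
  have hn0 : 0 < n := by rw [hn]; positivity
  have hx0 : 0 < ‖x‖ := by linarith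
  -- The half space in the direction of `x` lies outside the ball of radius `ρ`, so planar fronts
  -- suffice.
  set e : Space d := ‖x‖⁻¹ • x with he
  have he1 : ‖e‖ = 1 := by
    rw [he, norm_smul, norm_inv, norm_norm, inv_mul_cancel₀ hx0.ne']
  have hex : inner ℝ e x = ‖x‖ := by
    rw [he, real_inner_smul_left, real_inner_self_eq_norm_sq]; field_simp
  have hey : ∀ y : Space d, ρ ≤ inner ℝ e y → ρ ≤ ‖y‖ := fun y hy => by
    have := real_inner_le_norm e y
    rw [he1, one_mul] at this
    linarith
  -- The least slope with `(Aℓ)^n ≥ M`. The front starts at distance `ℓ` beyond `ρ` and travels at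
  -- most `ℓ` more, whence the `2ℓ`.
  set A : ℝ := M ^ (1 / n) / ℓ with hA
  have hA0 : 0 < A := by positivity
  have hAℓ : (A * ℓ) ^ n = M := by
    rw [hA, div_mul_cancel₀ _ hℓ.ne', ← Real.rpow_mul hM.le, one_div_mul_cancel hn0.ne',
      Real.rpow_one]
  have hAβ : A ^ (β + 1) = M ^ (γ + β) / ℓ ^ (β + 1) := by
    rw [hA, Real.div_rpow (by positivity) hℓ.le, ← Real.rpow_mul hM.le, hn]
    congr 2
    field_simp
  have hAβ0 : 0 < A ^ (β + 1) := by positivity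
  have hct : C * A ^ (β + 1) * (t₂ - t₁) ≤ ℓ := by
    have h1 : ℓ ^ (β + 2) = ℓ * ℓ ^ (β + 1) := by
      rw [← Real.rpow_one_add' hℓ.le (by linarith)]; ring_nf
    rw [h1] at hCM
    rw [hAβ, mul_div_assoc', div_mul_eq_mul_div, div_le_iff₀ (by positivity)]
    exact hCM
  have hC0 : 0 < C := lt_of_le_of_lt (by positivity) hC
  have hbound : ∀ ε : ℝ, 0 < ε → ε ≤ 1 → u x t ≤ (A * (ε / 2)) ^ n := by
    intro ε hε hε1
    have h1 := h.le_frontProfile hU hUb hT ha hγ hβ he1 hn hA0 hε hε1 hℓ hℓ1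
      (c := C * A ^ (β + 1)) (by gcongr) ht₁ ht₂ hct hAℓ.ge
      (fun y hy hyρ => hinit y hy (hey y hyρ)) (fun y hy hyρ => hlat y hy (hey y hyρ)) hx
      (by rw [hex]; linarith) ht
    refine h1.trans ?_
    refine Real.rpow_le_rpow (mul_nonneg hA0.le ((le_max_right _ _).trans
      (lt_half_add_sqrt hε _).le)) (mul_le_mul_of_nonneg_left ?_ hA0.le) hn0.le
    refine (half_add_sqrt_le hε _).trans ?_
    have h2 : C * A ^ (β + 1) * (t - t₁) ≤ C * A ^ (β + 1) * (t₂ - t₁) := by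
      gcongr; exact ht.2
    rw [max_eq_right (by rw [hex]; linarith), zero_add]
  refine le_antisymm ?_ (h.nonneg x hx t ⟨ht₁.trans ht.1, ht.2.trans ht₂⟩)
  have hlim : Filter.Tendsto (fun ε : ℝ => (A * (ε / 2)) ^ n) (nhdsWithin 0 (Set.Ioi 0))
      (nhds 0) := by
    have hc : Continuous fun ε : ℝ => (A * (ε / 2)) ^ n :=
      (by fun_prop : Continuous fun ε : ℝ => A * (ε / 2)).rpow_const fun _ => Or.inr hn0.le
    have := (hc.tendsto 0).mono_left (nhdsWithin_le_nhds (s := Set.Ioi 0))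
    simpa [Real.zero_rpow hn0.ne'] using this
  refine ge_of_tendsto hlim ?_
  filter_upwards [Ioo_mem_nhdsGT (zero_lt_one (α := ℝ))] with ε hε
  exact hbound ε hε.1 hε.2.le

end IsClassicalSolution

/-! ### Confinement of the support and conclusion -/

namespace IsClassicalSolution

variable {d : ℕ} {U : Set (Space d)} {T a σ De γ β : ℝ} {u₀ : Space d → ℝ}
  {u : Space d → ℝ → ℝ}

theorem eq_zero_initial (h : IsClassicalSolution U T a σ De γ β u₀ u) (hU : IsOpen U)
    (hT : 0 < T) {R₀ : ℝ} (hsupp : tsupport u₀ ⊆ Metric.ball 0 R₀) {x : Space d}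
    (hx : x ∈ closure U) (hxR : R₀ ≤ ‖x‖) : u x 0 = 0 := by
  by_cases hxU : x ∈ U
  · rw [h.initial x hxU]
    refine image_eq_zero_of_notMem_tsupport fun hmem => ?_
    have := mem_ball_zero_iff.mp (hsupp hmem)
    linarith
  · exact h.eq_zero_of_mem_frontier hT ⟨hx, by rwa [hU.interior_eq]⟩ ⟨le_rfl, hT.le⟩

/-- A pointwise bound with integrable front speed confines the support. -/
theorem eq_zero_of_pointwise_bound (h : IsClassicalSolution U T a σ De γ β u₀ u) (hU : IsOpen U)
    (hUb : Bornology.IsBounded U) (hT : 0 < T) (ha : 0 < a) (hγ : 0 < γ) (hβ : 0 ≤ β)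
    {n C ε ξ q ℓ ℓ' ρ : ℝ} (hn : n = (β + 1) / (γ + β))
    (hC : n ^ β * (σ ^ 2 / (2 * a) * (n + 1) + 3 * (|De / a| * d)) < C) (hρ : 0 < ρ)
    (hξ : 0 < ξ) (hε : 0 < ε) (hℓ : 0 < ℓ) (hℓ1 : ℓ ≤ 1) (hℓ' : 0 < ℓ') (hℓ'1 : ℓ' ≤ 1)
    (hq : q = (1 / 2) ^ (ξ / (β + 2))) (hCε : C * ε ≤ ℓ ^ (β + 2))
    (hinit : ∀ x ∈ closure U, ρ ≤ ‖x‖ → u x 0 = 0)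
    (hbound : ∀ t ∈ Set.Ioo 0 T, ∀ x ∈ closure U, ρ ≤ ‖x‖ →
      u x t ^ (γ + β) * t ≤ ε * (t / T) ^ ξ)
    {t : ℝ} (ht : t ∈ Set.Ioo 0 T) {x : Space d} (hx : x ∈ closure U)
    (hxρ : ρ + 2 * ℓ' + 2 * ℓ / (1 - q) ≤ ‖x‖) : u x t = 0 := by
  have hm : 0 < γ + β := by linarith
  have hb2 : 0 < β + 2 := by linarith
  have ht0 := ht.1
  have hn0 : 0 < n := by rw [hn]; positivity
  have hC0 : 0 < C := lt_of_le_of_lt (by positivity) hC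
  have hq0 : 0 < q := by rw [hq]; positivity
  have hq1 : q < 1 := by
    rw [hq]; exact Real.rpow_lt_one (by norm_num) (by norm_num) (by positivity)
  set L : ℝ := 2 * ℓ / (1 - q) with hL
  have hL0 : 0 < L := div_pos (by linarith) (by linarith)
  have hLq : L * q + 2 * ℓ = L := by
    have : L * (1 - q) = 2 * ℓ := div_mul_cancel₀ _ (by linarith)
    linarith
  -- On `[τ_(j+1), τ_j]` the hypothesis bounds `u^(γ+β)` by a multiple of `ε 2^(-jξ) / τ_j`, so a
  -- front step of width `ℓ q^j` with `q^(β+2) = 2^(-ξ)` is enough. The displacements `2ℓ q^j` sum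
  -- to `L`.
  set τ : ℕ → ℝ := fun j => t * (1 / 2) ^ j with hτ
  have hτ0 : ∀ j, 0 < τ j := fun j => by positivity
  have hτt : ∀ j, τ j ≤ t := fun j =>
    mul_le_of_le_one_right ht0.le (pow_le_one₀ (by norm_num) (by norm_num))
  have hτs : ∀ j, τ (j + 1) = τ j / 2 := fun j => by simp only [hτ]; rw [pow_succ]; ring
  set P : ℕ → Prop := fun j => ∀ x ∈ closure U, ρ + 2 * ℓ' + L * q ^ j ≤ ‖x‖ → u x (τ j) = 0
    with hP
  have hstep : ∀ j, P (j + 1) → P j := by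
    intro j hj y hy hyρ
    have hqj : q ^ j = ((1 / 2 : ℝ) ^ j) ^ (ξ / (β + 2)) := by
      rw [hq, ← Real.rpow_mul_natCast (by norm_num), ← Real.rpow_natCast_mul (by norm_num),
        mul_comm]
    have hqj0 : 0 < q ^ j := pow_pos hq0 j
    have hqj1 : q ^ j ≤ 1 := pow_le_one₀ hq0.le hq1.le
    set κ : ℝ := ((1 / 2 : ℝ) ^ j) ^ ξ with hκ
    have hκ0 : 0 < κ := by positivity
    have hqβ : (q ^ j) ^ (β + 2) = κ := by
      rw [hqj, ← Real.rpow_mul (by positivity), div_mul_cancel₀ _ hb2.ne']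
    have hMpos : 0 < 2 * ε * κ / τ j := div_pos (by positivity) (hτ0 j)
    have hMm : ((2 * ε * κ / τ j) ^ (1 / (γ + β))) ^ (γ + β) = 2 * ε * κ / τ j := by
      rw [← Real.rpow_mul hMpos.le, one_div_mul_cancel hm.ne', Real.rpow_one]
    refine h.eq_zero_of_front_step hU hUb hT ha hγ hβ (n := n) (C := C)
      (ρ := ρ + 2 * ℓ' + L * q ^ (j + 1)) (ℓ := ℓ * q ^ j)
      (M := (2 * ε * κ / τ j) ^ (1 / (γ + β))) (t₁ := τ (j + 1)) (t₂ := τ j)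
      hn hC (by positivity) (by positivity) (mul_le_one₀ hℓ1 hqj0.le hqj1)
      (Real.rpow_pos_of_pos hMpos _) (hτ0 _).le ((hτt j).trans ht.2.le) ?_ hj ?_ hy ?_ ?_
    · rw [hMm, hτs, Real.mul_rpow hℓ.le hqj0.le, hqβ]
      calc C * (2 * ε * κ / τ j) * (τ j - τ j / 2) = C * ε * κ := by
            have := (hτ0 j).ne'
            field_simp
            ring
        _ ≤ ℓ ^ (β + 2) * κ := by gcongr
    · intro z hz hzρ s hs
      have hs0 : 0 < s := (hτ0 _).trans_le hs.1
      have hsT : s < T := (hs.2.trans (hτt j)).trans_lt ht.2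
      have hz0 : 0 ≤ u z s := h.nonneg z hz s ⟨hs0.le, hsT.le⟩
      have h1 := hbound s ⟨hs0, hsT⟩ z hz (by
        have : 0 < L * q ^ (j + 1) := by positivity
        linarith)
      have h2 : (s / T) ^ ξ ≤ κ := by
        refine Real.rpow_le_rpow (by positivity) ?_ hξ.le
        rw [div_le_iff₀ hT]
        calc s ≤ t * (1 / 2) ^ j := hs.2
          _ ≤ T * (1 / 2) ^ j := by gcongr; exact ht.2.le
          _ = _ := mul_comm _ _
      have h3 : u z s ^ (γ + β) ≤ 2 * ε * κ / τ j := by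
        rw [le_div_iff₀ (hτ0 j)]
        have h4 : τ j ≤ 2 * s := by
          have := hs.1
          rw [hτs] at this
          linarith
        have h5 : 0 ≤ u z s ^ (γ + β) := Real.rpow_nonneg hz0 _
        calc u z s ^ (γ + β) * τ j ≤ u z s ^ (γ + β) * (2 * s) := by gcongr
          _ = 2 * (u z s ^ (γ + β) * s) := by ring
          _ ≤ 2 * (ε * (s / T) ^ ξ) := by gcongr
          _ ≤ 2 * (ε * κ) := by gcongr
          _ = 2 * ε * κ := by ring
      rw [← hMm] at h3
      exact (Real.rpow_le_rpow_iff hz0 (by positivity) hm).mp h3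
    · have h1 : L * q ^ (j + 1) + 2 * (ℓ * q ^ j) = L * q ^ j := by
        rw [pow_succ]
        nth_rewrite 2 [← hLq]
        ring
      linarith
    · exact ⟨by rw [hτs]; linarith [hτ0 j], le_rfl⟩
  have hdown : ∀ J, P J → P 0 := by
    intro J
    induction J with
    | zero => exact id
    | succ J ih => exact fun hJ => ih (hstep J hJ)
  obtain ⟨M, hM⟩ : ∃ M : ℝ, ∀ z ∈ closure U ×ˢ Set.Icc (0 : ℝ) T, u z.1 z.2 ≤ M := by
    obtain ⟨M, hM⟩ := ((hUb.isCompact_closure.prod isCompact_Icc).image_of_continuousOn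
      h.regular.continuousOn_closure).bddAbove
    exact ⟨M, fun z hz => hM ⟨z, hz, rfl⟩⟩
  set M' : ℝ := max M 1 with hM'
  have hM'0 : 0 < M' := lt_of_lt_of_le one_pos (le_max_right _ _)
  -- The dyadic steps never reach time zero. The remaining interval `[0, τ_J]` is crossed in one
  -- step with the crude maximum of `u`; only `J`, not the width `ℓ'`, depends on the solution.
  obtain ⟨J, hJ⟩ : ∃ J : ℕ, C * M' ^ (γ + β) * t * (1 / 2) ^ J ≤ ℓ' ^ (β + 2) := by
    have hK : 0 < C * M' ^ (γ + β) * t := by positivity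
    obtain ⟨J, hJ⟩ := exists_pow_lt_of_lt_one
      (show 0 < ℓ' ^ (β + 2) / (C * M' ^ (γ + β) * t) by positivity)
      (by norm_num : (1 / 2 : ℝ) < 1)
    rw [lt_div_iff₀ hK] at hJ
    exact ⟨J, by linarith⟩
  have hPJ : P J := by
    intro y hy hyρ
    have hLq0 : 0 < L * q ^ J := by positivity
    refine h.eq_zero_of_front_step hU hUb hT ha hγ hβ (n := n) (C := C) (ρ := ρ) (ℓ := ℓ')
      (M := M') (t₁ := 0) (t₂ := τ J) hn hC hρ hℓ' hℓ'1 hM'0 le_rfl ((hτt J).trans ht.2.le) ?_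
      hinit ?_ hy (by linarith) ⟨(hτ0 J).le, le_rfl⟩
    · rw [sub_zero]
      calc C * M' ^ (γ + β) * τ J = C * M' ^ (γ + β) * t * (1 / 2) ^ J := by
            simp only [hτ]; ring
        _ ≤ _ := hJ
    · intro z hz _ s hs
      exact (hM (z, s) ⟨hz, hs.1, hs.2.trans ((hτt J).trans ht.2.le)⟩).trans (le_max_left _ _)
  have h0 := hdown J hPJ x hx (by simpa using hxρ)
  simpa [hτ] using h0

theorem wMap_rpow_qExp (h : IsClassicalSolution U T a σ De γ β u₀ u) {θ : ℝ} (hγ : 0 < γ)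
    (hβ : 0 ≤ β) (hθ : 0 ≤ θ) {x : Space d} (hx : x ∈ U) {t : ℝ} (ht : t ∈ Set.Icc 0 T) :
    wMap θ γ β u x t ^ qExp θ γ β = u x t ^ (θ + 1) := by
  rw [wMap, ← Real.rpow_mul (h.nonneg x (subset_closure hx) t ht)]
  congr 1
  rw [qExp]
  field_simp

theorem lintegral_rpow_le_energyI (h : IsClassicalSolution U T a σ De γ β u₀ u) (hU : IsOpen U)
    {θ r : ℝ} (hγ : 0 < γ) (hβ : 0 ≤ β) (hθ : 0 ≤ θ) {τ : ℝ} (hτ : τ ∈ Set.Ioo 0 T) :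
    ∫⁻ x in extRegion U r 1, ENNReal.ofReal (u x τ ^ (θ + 1)) ≤ energyI U r θ γ β u 0 T := by
  refine le_trans ?_ le_self_add
  refine le_trans (le_of_eq ?_) (le_iSup₂ (f := fun τ (_ : τ ∈ Set.Ioo 0 T) =>
    ∫⁻ x in extRegion U r (0 + 1), ENNReal.ofReal (wMap θ γ β u x τ ^ qExp θ γ β)) τ hτ)
  refine MeasureTheory.setLIntegral_congr_fun
    (hU.measurableSet.diff Metric.isOpen_ball.measurableSet) fun x hx => ?_
  rw [h.wMap_rpow_qExp hγ hβ hθ hx.1 ⟨hτ.1.le, hτ.2.le⟩]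

end IsClassicalSolution

/-- The strict gap between `ρ` and the radius makes `w` vanish near every point of the region, so
its gradient vanishes too. -/
theorem energyI_eq_zero {d : ℕ} {U : Set (Space d)} (hU : IsOpen U) {r θ γ β T ρ : ℝ}
    (hγ : 0 < γ) (hβ : 0 ≤ β) (hθ : 0 ≤ θ) {u : Space d → ℝ → ℝ} {n : ℕ}
    (hρ : ρ < radius r (n + 1))
    (hu : ∀ t ∈ Set.Ioo 0 T, ∀ x ∈ U, ρ ≤ ‖x‖ → u x t = 0) : energyI U r θ γ β u n T = 0 := by
  have hw : ∀ t ∈ Set.Ioo 0 T, ∀ x ∈ U, ρ ≤ ‖x‖ → wMap θ γ β u x t = 0 := by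
    intro t ht x hx hxρ
    rw [wMap, hu t ht x hx hxρ]
    exact Real.zero_rpow (by positivity)
  have hq : qExp θ γ β ≠ 0 := by rw [qExp]; positivity
  have hext : ∀ x ∈ extRegion U r (n + 1), x ∈ U ∧ ρ < ‖x‖ := by
    intro x hx
    have h1 := hx.2
    rw [mem_ball_zero_iff, not_lt] at h1
    exact ⟨hx.1, by linarith⟩
  have hmeas : MeasurableSet (extRegion U r (n + 1)) :=
    hU.measurableSet.diff Metric.isOpen_ball.measurableSet
  rw [energyI, add_eq_zero]
  constructor
  · simp only [ENNReal.iSup_eq_zero]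
    intro t ht
    refine MeasureTheory.setLIntegral_eq_zero hmeas fun x hx => ?_
    obtain ⟨h1, h2⟩ := hext x hx
    rw [hw t ht x h1 h2.le, Real.zero_rpow hq]
    simp
  · refine MeasureTheory.setLIntegral_eq_zero measurableSet_Ioo fun t ht => ?_
    refine MeasureTheory.setLIntegral_eq_zero hmeas fun x hx => ?_
    obtain ⟨h1, h2⟩ := hext x hx
    have hev : (fun y => wMap θ γ β u y t) =ᶠ[nhds x] fun _ => 0 := by
      filter_upwards [hU.mem_nhds h1,
        (isOpen_lt continuous_const continuous_norm).mem_nhds h2] with y hy hyρ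
      exact hw t ht y hy (le_of_lt hyρ)
    rw [hev.gradient.eq_of_nhds, gradient_fun_const, norm_zero, Real.zero_rpow (by positivity)]
    simp

/-- Both factors are positive: `ζ < 1`, and `(β+2)/q = (θ+γ+β+1)/(θ+1) > 1`. This allows the power
`C_L^(-1/ε₀)` to be inverted. -/
theorem epsExp_ne_zero {d : ℕ} (hd : 1 ≤ d) {θ γ β : ℝ} (hγ : 0 < γ) (hβ : 0 ≤ β)
    (hθ : 0 ≤ θ) : epsExp d θ γ β ≠ 0 := by
  have hd' : (0 : ℝ) < d := by exact_mod_cast hd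
  rw [epsExp]
  refine mul_ne_zero ?_ ?_
  · rw [zetaExp, sub_ne_zero]
    refine (ne_of_lt ?_).symm
    rw [div_lt_one (by positivity)]
    have : 0 < d * (β + 2) * (θ + 1) := by positivity
    linarith
  · rw [qExp, sub_ne_zero]
    refine (ne_of_lt ?_).symm
    rw [lt_div_iff₀ (by positivity), one_mul, div_lt_iff₀ (by positivity), mul_comm]
    gcongr
    linarith

theorem mainTheorem2 (d : ℕ) (hd : 1 ≤ d)
    (U : Set (Space d)) (hU : IsOpen U) (hUb : Bornology.IsBounded U)
    (a σ De γ β θ p R₀ : ℝ) (ha : 0 < a) (hσ : 0 < σ ^ 2) (hγ : 0 < γ) (hβ : 0 ≤ β)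
    (hθ : 1 ≤ θ) (hp : β + 2 ≤ p) (hp' : p < (θ + γ) / (β + 1) - 2 * |De| / σ ^ 2)
    (hR₀ : 0 < R₀) :
    ∃ C_L : ℝ, 0 < C_L ∧
      ∀ (r T : ℝ) (u₀ : Space d → ℝ) (u : Space d → ℝ → ℝ),
        2 * R₀ < r → 0 < T → tsupport u₀ ⊆ Metric.ball 0 R₀ →
        IsClassicalSolution U T a σ De γ β u₀ u →
        energyI U r θ γ β u 0 T ≤
          ENNReal.ofReal (C_L ^ (-(1 / epsExp d θ γ β))
            * 2 ^ (-((β + 2) / epsExp d θ γ β ^ 2))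
            * T ^ (-((θ + 1) / (γ + β)))) →
        Filter.Tendsto (fun n : ℕ => energyI U r θ γ β u n T) Filter.atTop (nhds 0) := by
  have hm : 0 < γ + β := by linarith
  have hθ0 : 0 ≤ θ := by linarith
  set n : ℝ := (β + 1) / (γ + β) with hn
  set C : ℝ := n ^ β * (σ ^ 2 / (2 * a) * (n + 1) + 3 * (|De / a| * d)) + 1 with hC
  have hC0 : 0 < C := by positivity
  set ξ : ℝ := decayExp d θ γ β with hξ
  have hξ0 : 0 < ξ := by rw [hξ, decayExp]; positivity
  set q : ℝ := (1 / 2) ^ (ξ / (β + 2)) with hq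
  have hq1 : q < 1 := Real.rpow_lt_one (by norm_num) (by norm_num) (by positivity)
  -- The dyadic steps and the initial step each move the support by at most `R₀/10`. The total `R₀/5
  -- < r/10` fits between `8r/5` and `17r/10`.
  set ℓ : ℝ := min 1 (R₀ / 20 * (1 - q)) with hℓ
  have hℓ0 : 0 < ℓ := lt_min one_pos (mul_pos (by positivity) (by linarith))
  set ℓ' : ℝ := min 1 (R₀ / 20) with hℓ'
  have hℓ'0 : 0 < ℓ' := lt_min one_pos (by positivity)
  set ε : ℝ := min 1 (ℓ ^ (β + 2) / C) with hε
  have hε0 : 0 < ε := lt_min one_pos (by positivity)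
  obtain ⟨δ, hδ, hpoint⟩ := IsClassicalSolution.exists_pointwise_bound hd hU hUb (De := De) ha hσ
    hγ hβ hθ0 hR₀ hε0 (min_le_left _ _)
  -- Then `C_L^(-1/ε₀) = δ`; the power of `2` in the hypothesis is at most `1` and only helps.
  refine ⟨δ ^ (-epsExp d θ γ β), by positivity, ?_⟩
  intro r T u₀ u hr hT hsupp h henergy
  have hthr : (δ ^ (-epsExp d θ γ β)) ^ (-(1 / epsExp d θ γ β))
      * 2 ^ (-((β + 2) / epsExp d θ γ β ^ 2)) * T ^ (-((θ + 1) / (γ + β))) ≤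
      δ * T ^ (-((θ + 1) / (γ + β))) := by
    have h1 : (δ ^ (-epsExp d θ γ β)) ^ (-(1 / epsExp d θ γ β)) = δ := by
      rw [← Real.rpow_mul hδ.le, neg_mul_neg, mul_one_div_cancel (epsExp_ne_zero hd hγ hβ hθ0),
        Real.rpow_one]
    have h2 : (2 : ℝ) ^ (-((β + 2) / epsExp d θ γ β ^ 2)) ≤ 1 :=
      Real.rpow_le_one_of_one_le_of_nonpos one_le_two (neg_nonpos.mpr (by positivity))
    rw [h1]
    gcongr
    exact mul_le_of_le_one_right hδ.le h2
  have hbound := hpoint r T u₀ u hr hT h fun τ hτ =>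
    (h.lintegral_rpow_le_energyI hU hγ hβ hθ0 hτ).trans
      (henergy.trans (ENNReal.ofReal_le_ofReal hthr))
  have hzero : ∀ t ∈ Set.Ioo 0 T, ∀ x ∈ U, 17 / 10 * r ≤ ‖x‖ → u x t = 0 := by
    intro t ht x hx hxr
    refine h.eq_zero_of_pointwise_bound hU hUb hT ha hγ hβ hn (C := C) (by rw [hC]; linarith)
      (ρ := 8 / 5 * r) (by linarith) hξ0 hε0 hℓ0 (min_le_left _ _) hℓ'0 (min_le_left _ _) hq ?_
      (fun y hy hyr => h.eq_zero_initial hU hT hsupp hy (by linarith)) hbound ht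
      (subset_closure hx) ?_
    · rw [mul_comm, ← le_div_iff₀ hC0]
      exact min_le_right _ _
    · have h1 : 2 * ℓ / (1 - q) ≤ R₀ / 10 := by
        rw [div_le_iff₀ (by linarith)]
        have := min_le_right 1 (R₀ / 20 * (1 - q))
        linarith
      have h2 : ℓ' ≤ R₀ / 20 := min_le_right _ _
      linarith
  refine tendsto_const_nhds.congr' ?_
  -- For `k ≥ 1` the region of `I_k` starts at `r_(k+1) ≥ 7r/4 > 17r/10`. The region of `I_0` starts
  -- at `3r/2` and is not covered.
  filter_upwards [Filter.eventually_ge_atTop 1] with k hk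
  refine (energyI_eq_zero hU hγ hβ hθ0 (ρ := 17 / 10 * r) ?_ hzero).symm
  have h1 : (1 : ℝ) / 2 ^ (k + 1 + 1) ≤ 1 / 2 ^ 3 := by
    apply one_div_le_one_div_of_le (by positivity)
    exact pow_le_pow_right₀ one_le_two (by omega)
  rw [radius]
  norm_num at h1 ⊢
  nlinarith
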